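/- Let $n\ge 3$, let $N$ be a non-empty compact smooth $(n-1)$-manifold without boundary, let $k\in\{-1,0,1\}$ and let $\mathring h$ be a smooth Riemannian metric on $N$ of constant scalar curvature $(n-1)(n-2)k$. Put $f_1=\sinh$, $f_0=\exp$, $f_{-1}=\cosh$. A reference locally hyperbolic metric is a metric $dr^2+f_{k'}(r+r_0)^2\,h'$ on $[0,\infty)\times N$ with $k'\in\{-1,0,1\}$, $r_0>0$ and $h'$ a smooth Riemannian metric on $N$ of constant scalar curvature $(n-1)(n-2)k'$. Let $f:[0,\infty)\to\mathbb R$ be smooth and positive and let $\mathring g_f=dz^2+f(z)^2\,\mathring h$ on $[0,\infty)\times N$. A diffeomorphism $\Phi$ is called conformal from $g$ to $g'$ if $\Phi^*g'=u\,g$ for a smooth positive function $u$. The following are equivalent: 1. $\mathring g_f$ is conformal near infinity to a reference locally hyperbolic metric with the same $k$ and $\mathring h$, by a change of the radial variable: there are $z_0\ge 0$, $r_0>0$ and a function $K$ such that $(z,\theta)\mapsto(K(z),\theta)$ is a smooth conformal diffeomorphism from $([z_0,\infty)\times N,\ \mathring g_f)$ onto $([0,\infty)\times N,\ dr^2+f_k(r+r_0)^2\,\mathring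 h)$; moreover $z_0=0$ if $\int_0^\infty \frac{ds}{f(s)}<\int_0^\infty\frac{dr}{f_k(r)}$ (the right-hand side is $\infty$, $1$, $\pi/2$ for $k=1,0,-1$). 2. $\mathring g_f$ is conformal near infinity to some reference locally hyperbolic metric: for some $z_0\ge0$ there is a smooth conformal diffeomorphism from $([z_0,\infty)\times N,\ \mathring g_f)$ onto $[0,\infty)\times N$ with some reference locally hyperbolic metric. 3. $\displaystyle I(f):=\int_0^\infty\frac{1}{f(s)}\,ds<\infty$. Moreover, if $I(f)=\infty$, then there is a function $K$ such that $(z,\theta)\mapsto(K(z),\theta)$ is a smooth conformal diffeomorphism from $([0,\infty)\times N,\ \mathring g_f)$ onto $([0,\infty)\times N,\ d\check z^2+e^{-2\check z}\,\mathring h)$. The metric $d\check z^2+e^{-2\check z}\,\mathring h$ on $[0,\infty)\times N$ is complete and has finite volume. -/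

import Mathlib

open Set Filter MeasureTheory
open scoped Manifold ContDiff ENNReal Topology

noncomputable section

namespace WarpedConformal

section General

variable {E : Type*} [NormedAddCommGroup E] [NormedSpace ℝ E]
  {H : Type*} [TopologicalSpace H] (I : ModelWithCorners ℝ E H)
  {M : Type*} [TopologicalSpace M] [ChartedSpace H M]

/-- A field of (real-valued) forms on the tangent spaces of `M`; the Riemannian metrics below are
given by their values `g p v w`. -/
abbrev MetricField (M : Type*) [TopologicalSpace M] [ChartedSpace H M] :=
  ∀ p : M, TangentSpace I p → TangentSpace I p → ℝ

/-- A smooth Riemannian metric on the manifold `M`. -/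
abbrev SmoothMetric (M : Type*) [TopologicalSpace M] [ChartedSpace H M] [IsManifold I ∞ M] :=
  Bundle.ContMDiffRiemannianMetric I ∞ E (fun x : M => TangentSpace I x)

section Coordinates

variable [FiniteDimensional ℝ E]

variable (E) in
/-- The index set of the coordinates given by the basis `Module.finBasis ℝ E` of the model
space `E`. -/
abbrev CoordIdx := Fin (Module.finrank ℝ E)

/-- The matrix `g_{ij}` of `g` in the chart of `M` centred at `c`, with respect to the linear
coordinates of `E` given by its basis `Module.finBasis ℝ E`, as a function on the chart's
target. The manifold is without boundary. -/
def coordMetric (g : MetricField I M) (c : M) (y : E) : Matrix (CoordIdx E) (CoordIdx E) ℝ :=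
  Matrix.of fun i j =>
    g ((extChartAt I c).symm y)
      (mfderiv 𝓘(ℝ, E) I (extChartAt I c).symm y (Module.finBasis ℝ E i))
      (mfderiv 𝓘(ℝ, E) I (extChartAt I c).symm y (Module.finBasis ℝ E j))

/-- The `i`-th partial derivative of a function on `E`. -/
def partialD (i : CoordIdx E) (u : E → ℝ) (y : E) : ℝ :=
  fderiv ℝ u y (Module.finBasis ℝ E i)

/-- Christoffel symbols
`Γ^k_{ij} = (1/2) g^{kl} (∂_i g_{jl} + ∂_j g_{il} - ∂_l g_{ij})` in the chart centred at `c`. -/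
def christoffel (g : MetricField I M) (c : M) (k i j : CoordIdx E) (y : E) : ℝ :=
  (1 / 2) * ∑ l, (coordMetric I g c y)⁻¹ k l *
    (partialD i (fun x => coordMetric I g c x j l) y
      + partialD j (fun x => coordMetric I g c x i l) y
      - partialD l (fun x => coordMetric I g c x i j) y)

/-- Ricci curvature
`R_{jk} = ∂_i Γ^i_{jk} - ∂_k Γ^i_{ij} + Γ^i_{ip} Γ^p_{jk} - Γ^i_{kp} Γ^p_{ij}`
in the chart centred at `c`. -/
def ricci (g : MetricField I M) (c : M) (j k : CoordIdx E) (y : E) : ℝ :=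
  ∑ i, (partialD i (christoffel I g c i j k) y - partialD k (christoffel I g c i i j) y
    + ∑ p, (christoffel I g c i i p y * christoffel I g c p j k y
      - christoffel I g c i k p y * christoffel I g c p i j y))

/-- The scalar curvature `S_g = g^{jk} R_{jk}` at the point `p`. -/
def scalarCurvature (g : MetricField I M) (p : M) : ℝ :=
  ∑ j, ∑ k, (coordMetric I g p (extChartAt I p p))⁻¹ j k * ricci I g p j k (extChartAt I p p)

/-- The Riemannian volume of the set `S`: the infimum of `∑ i, ∫_{A i} √(det g_{ab}) dx` over all
countable covers of `S` by measurable sets, each contained in the domain of a chart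
(`A i` is the coordinate image of the `i`-th set of the cover). -/
def riemannianVolume [MeasurableSpace E] [BorelSpace E] (g : MetricField I M) (S : Set M) : ℝ≥0∞ :=
  ⨅ (c : ℕ → M) (A : ℕ → Set E)
    (_ : ∀ i, MeasurableSet (A i) ∧ A i ⊆ (extChartAt I (c i)).target)
    (_ : S ⊆ ⋃ i, (extChartAt I (c i)).symm '' A i),
    ∑' i, ∫⁻ y in A i, ENNReal.ofReal (√ (coordMetric I g (c i) y).det)
      ∂(Module.finBasis ℝ E).addHaar

end Coordinates

/-- The length, with respect to `g`, of a path parametrised by `[0, 1]`. -/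
def pathLength (g : MetricField I M) (γ : ℝ → M) : ℝ≥0∞ :=
  ∫⁻ t in Icc (0 : ℝ) 1, ENNReal.ofReal
    (√ (g (γ t) (mfderivWithin 𝓘(ℝ, ℝ) I γ (Icc 0 1) t (1 : ℝ))
      (mfderivWithin 𝓘(ℝ, ℝ) I γ (Icc 0 1) t (1 : ℝ))))

/-- The intrinsic Riemannian distance of `(S, g)`: the infimum of the lengths of the `C^1` paths
that stay in `S` (it is `∞` if there is no such path). -/
def riemannianDistOn (g : MetricField I M) (S : Set M) (x y : M) : ℝ≥0∞ :=
  ⨅ (γ : ℝ → M) (_ : ContMDiffOn 𝓘(ℝ, ℝ) I 1 γ (Icc 0 1)) (_ : MapsTo γ (Icc 0 1) S)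
    (_ : γ 0 = x) (_ : γ 1 = y), pathLength I g γ

/-- `(S, g)` is complete: every Cauchy sequence for the Riemannian distance of `(S, g)`
converges in `S`. -/
def IsCompleteOn (g : MetricField I M) (S : Set M) : Prop :=
  ∀ x : ℕ → M, (∀ n, x n ∈ S) →
    (∀ ε : ℝ≥0∞, 0 < ε → ∃ n₀, ∀ m ≥ n₀, ∀ n ≥ n₀, riemannianDistOn I g S (x m) (x n) < ε) →
    ∃ p ∈ S, Tendsto (fun n => riemannianDistOn I g S (x n) p) atTop (𝓝 0)

/-- `Φ` restricts to a smooth conformal diffeomorphism from `(S, g₁)` onto `(T, g₂)`: a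
diffeomorphism with `Φ^* g₂ = u g₁` on `S` for a smooth positive function `u`. -/
structure IsConformalDiffeoOn (g₁ : MetricField I M) (S : Set M) (g₂ : MetricField I M) (T : Set M)
    (Φ : M → M) : Prop where
  bijOn : BijOn Φ S T
  smooth : ContMDiffOn I I ∞ Φ S
  smooth_inv : ∃ Ψ : M → M, InvOn Ψ Φ S T ∧ ContMDiffOn I I ∞ Ψ T
  conformal : ∃ u : M → ℝ, ContMDiffOn I 𝓘(ℝ, ℝ) ∞ u S ∧ (∀ p ∈ S, 0 < u p) ∧
    ∀ p ∈ S, ∀ v w : TangentSpace I p,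
      g₂ (Φ p) (mfderivWithin I I Φ S p v) (mfderivWithin I I Φ S p w) = u p * g₁ p v w

end General

section Warped

variable {E : Type*} [NormedAddCommGroup E] [NormedSpace ℝ E]
  {H : Type*} [TopologicalSpace H] {I : ModelWithCorners ℝ E H}
  {N : Type*} [TopologicalSpace N] [ChartedSpace H N] [IsManifold I ∞ N]

/-- The half-cylinder `[a, ∞) × N`, as a subset of the manifold `ℝ × N`. -/
def halfCyl (N : Type*) (a : ℝ) : Set (ℝ × N) := Ici a ×ˢ univ

/-- The warped product `dz² + f(z)² h` on (a part of) `ℝ × N`. -/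
def warped (f : ℝ → ℝ) (h : SmoothMetric I N) : MetricField (𝓘(ℝ, ℝ).prod I) (ℝ × N) :=
  fun p v w =>
    (show ℝ from mfderiv (𝓘(ℝ, ℝ).prod I) 𝓘(ℝ, ℝ) Prod.fst p v)
      * (show ℝ from mfderiv (𝓘(ℝ, ℝ).prod I) 𝓘(ℝ, ℝ) Prod.fst p w)
    + f p.1 ^ 2 * h.inner p.2 (mfderiv (𝓘(ℝ, ℝ).prod I) I Prod.snd p v)
        (mfderiv (𝓘(ℝ, ℝ).prod I) I Prod.snd p w)

/-- The profile `f_k` of the locally hyperbolic reference metrics, for `k ∈ {-1, 0, 1}`. -/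
def profile : SignType → ℝ → ℝ
  | .pos => Real.sinh
  | .zero => Real.exp
  | .neg => Real.cosh

/-- The warped product `dr² + f_k(r + r₀)² h`. -/
def refMetric (k : SignType) (r₀ : ℝ) (h : SmoothMetric I N) :
    MetricField (𝓘(ℝ, ℝ).prod I) (ℝ × N) :=
  warped (fun r => profile k (r + r₀)) h

variable [FiniteDimensional ℝ E]

/-- The metric `h` on the `(n-1)`-manifold `N` has constant scalar curvature
`(n - 1) (n - 2) k`. -/
def HasConstScalar (n : ℕ) (k : SignType) (h : SmoothMetric I N) : Prop :=
  ∀ p : N, scalarCurvature I (fun q v w => h.inner q v w) p = ((n : ℝ) - 1) * ((n : ℝ) - 2) * (k : ℝ)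

/-- The end of `[0, ∞) × N` with the metric `g` is conformal to some locally hyperbolic
reference metric: for some `z₀ ≥ 0`, some diffeomorphism `[z₀, ∞) × N → [0, ∞) × N` is
conformal from `g` to `dr² + f_k(r + r₀)² h` for some `k ∈ {-1, 0, 1}`, some `r₀ > 0` and some
metric `h` on `N` of constant scalar curvature `(n - 1) (n - 2) k`. -/
def EndConformalToLocallyHyperbolic (n : ℕ) (g : MetricField (𝓘(ℝ, ℝ).prod I) (ℝ × N)) : Prop :=
  ∃ (k : SignType) (h : SmoothMetric I N) (r₀ z₀ : ℝ) (Φ : ℝ × N → ℝ × N),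
    HasConstScalar n k h ∧ 0 < r₀ ∧ 0 ≤ z₀ ∧
    IsConformalDiffeoOn (𝓘(ℝ, ℝ).prod I) g (halfCyl N z₀) (refMetric k r₀ h) (halfCyl N 0) Φ

end Warped

end WarpedConformal

end

/-! Put p(z) = ∫_0^z ds/f. Then dz² + f² h = f² (dp² + h), so up to a conformal factor the metric is
a product cylinder over N of length I(f). An increasing radial change K is conformal onto a target
with profile F as soon as dK / F(K) = dz / f. If I(f) is finite, the equation for f_k is solved by
matching the tail integrals of 1/f and 1/f_k at infinity (`exists_inverse_tail`,
`exists_radial_change`); the only constraint is that the tail of 1/f left beyond z₀ be shorter than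
the total integral of 1/f_k. If I(f) is infinite, e^K = 1 + p solves the equation for the cusp.

The substantial implication is 2 → 3: a cylinder of finite length is not conformal, by any map
whatsoever, to one of infinite length. This is a length-area argument. Let g be the reference
profile, Ψ the inverse of the conformal map, ζ its radial component and m = dim N. Conformality
bounds |∂_r(p∘ζ)|^{m+1} g^m by a constant times the Jacobian of Ψ divided by f(ζ)
(`abs_div_pow_mul_le_of_conformal`). Along each radial line p∘ζ climbs from a bounded value to p(Z).
The splitting |x| ≤ M/g + |x|^{m+1} g^m / M^m, integrated over all lines, bounds this climb by M ∫
1/g plus M^{-m} times an integral of Jacobians, and by change of variables the latter is at most a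
constant times p(Z). For large M it is absorbed, so p is bounded
(`lintegral_one_div_lt_top_of_jacobian_bound`).

The cusp is complete because a Cauchy sequence stays at bounded height, where the warping factor is
bounded below and the compact base takes over. Its volume is finite because the volume density
decays like e^{-mz}. -/

namespace WarpedConformal

/-! ### Inverse functions on half-lines -/

/-- A smooth function on a half-line with positive derivative, tending to infinity, has a smooth
inverse. -/
theorem exists_smooth_inverse_Ici {a b : ℝ} {K K' : ℝ → ℝ} (hK : ContDiffOn ℝ ∞ K (Ici a))
    (hK' : ∀ z ∈ Ici a, HasDerivWithinAt K (K' z) (Ici a) z) (hpos : ∀ z ∈ Ici a, 0 < K' z)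
    (hab : K a = b) (hlim : Tendsto K atTop atTop) :
    ∃ L : ℝ → ℝ, BijOn K (Ici a) (Ici b) ∧ InvOn L K (Ici a) (Ici b) ∧
      ContDiffOn ℝ ∞ L (Ici b) := by
  have hmono : StrictMonoOn K (Ici a) := by
    refine strictMonoOn_of_hasDerivWithinAt_pos (convex_Ici a) hK.continuousOn
      (fun x hx => ?_) (fun x hx => hpos x (interior_subset hx))
    rw [interior_Ici] at hx ⊢
    exact (hK' x (mem_Ici.2 (mem_Ioi.1 hx).le)).mono Ioi_subset_Ici_self
  -- Extending K with slope 1 to the left of a gives an order isomorphism of ℝ, whose inverse is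
  -- continuous without further work.
  set Q : ℝ → ℝ := fun z => K (max z a) + min (z - a) 0 with hQ
  have hQK : ∀ z ∈ Ici a, Q z = K z := fun z hz => by
    have : a ≤ z := hz
    simp [hQ, this]
  have hQa : ∀ z ≤ a, Q z = b + (z - a) := fun z hz => by simp [hQ, hz, hab]
  have hQc : Continuous Q := by
    have h1 : Continuous fun z => K (max z a) :=
      hK.continuousOn.comp_continuous (by fun_prop) fun z => le_max_right z a
    exact h1.add (by fun_prop)
  have hQm : StrictMono Q := by
    intro x y hxy
    rcases le_or_gt a x with hx | hx
    · rw [hQK x hx, hQK y (hx.trans hxy.le)]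
      exact hmono hx (hx.trans hxy.le) hxy
    · have h1 : K (max x a) ≤ K (max y a) := hmono.monotoneOn (le_max_right x a)
        (le_max_right y a) (max_le_max_right _ hxy.le)
      have h2 : min (x - a) 0 < min (y - a) 0 := by
        rw [min_eq_left (by linarith)]
        exact lt_min (by linarith) (by linarith)
      simp only [hQ]
      linarith
  have hQtop : Tendsto Q atTop atTop := by
    refine hlim.congr' ?_
    filter_upwards [eventually_ge_atTop a] with z hz using (hQK z hz).symm
  have hQbot : Tendsto Q atBot atBot := by
    have : Tendsto (fun z : ℝ => (b - a) + z) atBot atBot :=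
      tendsto_atBot_add_const_left _ _ tendsto_id
    refine this.congr' ?_
    filter_upwards [eventually_le_atBot a] with z hz
    rw [hQa z hz]; ring
  have hQs : Function.Surjective Q := hQc.surjective hQtop hQbot
  set e := hQm.orderIsoOfSurjective Q hQs
  have hQL : ∀ y, Q (e.symm y) = y := fun y => e.apply_symm_apply y
  have hLQ : ∀ z, e.symm (Q z) = z := fun z => e.symm_apply_apply z
  have hLmem : ∀ y ∈ Ici b, e.symm y ∈ Ici a := by
    intro y hy
    have h1 : Q a = b := by rw [hQK a self_mem_Ici, hab]
    have : e.symm (Q a) ≤ e.symm y := e.symm.monotone (by rw [h1]; exact hy)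
    rwa [hLQ] at this
  have hKmem : ∀ z ∈ Ici a, K z ∈ Ici b := fun z hz => by
    rw [← hab]; exact hmono.monotoneOn self_mem_Ici hz hz
  have hinv : InvOn e.symm K (Ici a) (Ici b) :=
    ⟨fun z hz => by rw [← hQK z hz, hLQ], fun y hy => by rw [← hQK _ (hLmem y hy), hQL]⟩
  have hLc : Continuous e.symm := e.symm.continuous
  have hLd : ∀ y ∈ Ici b, HasDerivWithinAt e.symm (K' (e.symm y))⁻¹ (Ici b) y := by
    intro y hy
    have h0 := (hpos _ (hLmem y hy)).ne'
    have h1 : HasFDerivWithinAt K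
        (ContinuousLinearEquiv.unitsEquivAut ℝ (Units.mk0 _ h0) : ℝ →L[ℝ] ℝ) (Ici a) (e.symm y) := by
      convert! (hK' _ (hLmem y hy)).hasFDerivWithinAt using 1
    have h2 := HasFDerivWithinAt.of_local_left_inverse (g := e.symm) (s := Ici b)
      (tendsto_nhdsWithin_of_tendsto_nhds_of_eventually_within _
        ((hLc.tendsto y).mono_left nhdsWithin_le_nhds)
        (by filter_upwards [self_mem_nhdsWithin] with z hz using hLmem z hz)) h1 hy
      (by filter_upwards [self_mem_nhdsWithin] with z hz using hinv.2 hz)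
    convert! h2.hasDerivWithinAt using 1
    simp [ContinuousLinearEquiv.unitsEquivAut]
  have hdw : ContDiffOn ℝ ∞ K' (Ici a) := by
    refine (hK.derivWithin (uniqueDiffOn_Ici a) (m := ∞) (by simp)).congr fun z hz => ?_
    exact ((hK' z hz).derivWithin (uniqueDiffOn_Ici a z hz)).symm
  -- Bootstrapping: the derivative of the inverse L is 1 / K'(L), so L of class C^k has a derivative
  -- of class C^k.
  have hLn : ∀ k : ℕ, ContDiffOn ℝ k e.symm (Ici b) := by
    intro k
    induction k with
    | zero => exact contDiffOn_zero.2 hLc.continuousOn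
    | succ k ih =>
      push_cast
      refine (contDiffOn_succ_iff_derivWithin (uniqueDiffOn_Ici b)).2
        ⟨fun y hy => (hLd y hy).differentiableWithinAt, by simp, ?_⟩
      have h1 : ContDiffOn ℝ k (fun y => (K' (e.symm y))⁻¹) (Ici b) :=
        ((hdw.of_le (mod_cast le_top)).comp ih hLmem).inv fun y hy => (hpos _ (hLmem y hy)).ne'
      exact h1.congr fun y hy => (hLd y hy).derivWithin (uniqueDiffOn_Ici b y hy)
  refine ⟨e.symm, ⟨hKmem, hmono.injOn, ?_⟩, hinv, contDiffOn_infty.2 hLn⟩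
  exact fun y hy => ⟨e.symm y, hLmem y hy, hinv.2 hy⟩

/-! ### The conformal length p(z) = ∫_0^z 1/f -/

section Primitive

/-- The primitive of `1 / f` on `[0, ∞)`, extended by a linear function to negative arguments. -/
noncomputable def recipPrimitive (f : ℝ → ℝ) (z : ℝ) : ℝ := ∫ s in (0 : ℝ)..z, 1 / f (max s 0)

variable {f : ℝ → ℝ} (hf : ContinuousOn f (Ici 0)) (hpos : ∀ z ∈ Ici (0 : ℝ), 0 < f z)

-- Freezing the argument of f at 0 for s < 0 keeps the integrand continuous and positive on all of
-- ℝ, so the primitive is differentiable and strictly increasing on the whole line.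
include hf hpos in
theorem continuous_one_div_max : Continuous fun s => 1 / f (max s 0) := by
  have : Continuous fun s => f (max s 0) :=
    hf.comp_continuous (by fun_prop) fun s => le_max_right s 0
  exact continuous_const.div this fun s => (hpos _ (le_max_right s 0)).ne'

include hf hpos in
theorem hasDerivAt_recipPrimitive (z : ℝ) :
    HasDerivAt (recipPrimitive f) (1 / f (max z 0)) z :=
  (continuous_one_div_max hf hpos).integral_hasStrictDerivAt 0 z |>.hasDerivAt

include hf hpos in
theorem strictMono_recipPrimitive : StrictMono (recipPrimitive f) :=
  strictMono_of_hasDerivAt_pos (fun z => hasDerivAt_recipPrimitive hf hpos z)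
    fun z => one_div_pos.2 (hpos _ (le_max_right z 0))

theorem recipPrimitive_zero : recipPrimitive f 0 = 0 := by simp [recipPrimitive]

theorem contDiffOn_recipPrimitive (hf : ContDiffOn ℝ ∞ f (Ici 0))
    (hpos : ∀ z ∈ Ici (0 : ℝ), 0 < f z) : ContDiffOn ℝ ∞ (recipPrimitive f) (Ici 0) := by
  have h : ContDiffOn ℝ ∞ (fun z => 1 / f z) (Ici 0) :=
    contDiffOn_const.div hf fun z hz => (hpos z hz).ne'
  rw [contDiffOn_infty_iff_derivWithin (uniqueDiffOn_Ici 0)]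
  refine ⟨fun z _ => (hasDerivAt_recipPrimitive hf.continuousOn hpos
    z).differentiableAt.differentiableWithinAt, h.congr fun z hz => ?_⟩
  rw [(hasDerivAt_recipPrimitive hf.continuousOn hpos z).hasDerivWithinAt.derivWithin
    (uniqueDiffOn_Ici 0 z hz), max_eq_left hz]

include hf hpos in
theorem lintegral_Icc_one_div {z : ℝ} (hz : 0 ≤ z) :
    ∫⁻ s in Icc 0 z, ENNReal.ofReal (1 / f s) = ENNReal.ofReal (recipPrimitive f z) := by
  have hc := continuous_one_div_max hf hpos
  rw [recipPrimitive, intervalIntegral.integral_of_le hz, ← integral_Icc_eq_integral_Ioc,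
    ofReal_integral_eq_lintegral_ofReal hc.integrableOn_Icc
    (Eventually.of_forall fun s => (one_div_pos.2 (hpos _ (le_max_right s 0))).le)]
  exact setLIntegral_congr_fun measurableSet_Icc fun s hs => by simp [hs.1]

include hf hpos in
theorem lintegral_Ici_one_div_le {C : ℝ} (h : ∀ z, 0 ≤ z → recipPrimitive f z ≤ C) :
    ∫⁻ s in Ici 0, ENNReal.ofReal (1 / f s) ≤ ENNReal.ofReal C := by
  have h1 : (Ici (0 : ℝ)) = ⋃ n : ℕ, Icc 0 (n : ℝ) := by
    ext x
    simp only [mem_Ici, mem_iUnion, mem_Icc]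
    exact ⟨fun hx => (exists_nat_ge x).imp fun n hn => ⟨hx, hn⟩, fun ⟨n, hn⟩ => hn.1⟩
  rw [h1, setLIntegral_iUnion_of_directed]
  · refine iSup_le fun n => ?_
    rw [lintegral_Icc_one_div hf hpos n.cast_nonneg]
    exact ENNReal.ofReal_le_ofReal (h _ n.cast_nonneg)
  · refine Monotone.directed_le fun i j hij => Icc_subset_Icc_right (mod_cast hij)

include hf hpos in
theorem tendsto_recipPrimitive_atTop (h : ¬ ∫⁻ s in Ici 0, ENNReal.ofReal (1 / f s) < ⊤) :
    Tendsto (recipPrimitive f) atTop atTop := by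
  refine tendsto_atTop_atTop_of_monotone (strictMono_recipPrimitive hf hpos).monotone fun C => ?_
  by_contra! hC
  exact h ((lintegral_Ici_one_div_le hf hpos fun z _ => (hC z).le).trans_lt ENNReal.ofReal_lt_top)

include hf hpos in
/-- If `1 / f` is integrable, its primitive converges to the total integral from below. -/
theorem exists_tendsto_recipPrimitive (h : ∫⁻ s in Ici 0, ENNReal.ofReal (1 / f s) < ⊤) :
    ∃ Λ : ℝ, ENNReal.ofReal Λ = ∫⁻ s in Ici 0, ENNReal.ofReal (1 / f s) ∧
      Tendsto (recipPrimitive f) atTop (𝓝 Λ) ∧ ∀ z, recipPrimitive f z < Λ := by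
  have hmono := strictMono_recipPrimitive hf hpos
  have hbd : ∀ z, 0 ≤ z →
      recipPrimitive f z ≤ (∫⁻ s in Ici 0, ENNReal.ofReal (1 / f s)).toReal := by
    intro z hz
    rw [← ENNReal.ofReal_le_iff_le_toReal h.ne, ← lintegral_Icc_one_div hf hpos hz]
    exact lintegral_mono_set Icc_subset_Ici_self
  have hbdd : BddAbove (range (recipPrimitive f)) := by
    refine ⟨(∫⁻ s in Ici 0, ENNReal.ofReal (1 / f s)).toReal, ?_⟩
    rintro _ ⟨z, rfl⟩
    exact (hmono.monotone (le_max_left z 0)).trans (hbd _ (le_max_right z 0))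
  refine ⟨⨆ z, recipPrimitive f z, le_antisymm ?_ ?_, tendsto_atTop_ciSup hmono.monotone hbdd,
    fun z => (hmono (lt_add_one z)).trans_le (le_ciSup hbdd _)⟩
  · rw [ENNReal.ofReal_le_iff_le_toReal h.ne]
    refine ciSup_le fun z => ?_
    exact (hmono.monotone (le_max_left z 0)).trans (hbd _ (le_max_right z 0))
  · exact lintegral_Ici_one_div_le hf hpos fun z _ => le_ciSup hbdd z

end Primitive

/-! ### The profiles sinh, exp, cosh and their tail integrals -/

section Profile

/-- Of the three profiles sinh is the smallest, and sinh(r + r₀) - sinh(r₀) e^r = e^{-r₀} (e^r -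
e^{-r}) / 2. This single lower bound yields both positivity and integrability of the reciprocal. -/
theorem sinh_mul_exp_le_profile (k : SignType) {r₀ r : ℝ} (hr : 0 ≤ r) :
    Real.sinh r₀ * Real.exp r ≤ profile k (r + r₀) := by
  have h1 : Real.sinh r₀ * Real.exp r ≤ Real.sinh (r + r₀) := by
    rw [Real.sinh_eq, Real.sinh_eq, Real.exp_add, neg_add, Real.exp_add]
    have h2 : Real.exp (-r) ≤ Real.exp r := Real.exp_le_exp.2 (by linarith)
    nlinarith [Real.exp_pos (-r₀)]
  rcases k with _ | _ | _
  · refine h1.trans ?_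
    change _ ≤ Real.exp (r + r₀)
    rw [Real.sinh_eq]
    linarith [Real.exp_pos (r + r₀), Real.exp_pos (-(r + r₀))]
  · exact h1.trans (Real.sinh_lt_cosh _).le
  · exact h1

theorem profile_pos (k : SignType) {r : ℝ} (hr : 0 < r) : 0 < profile k r := by
  have := sinh_mul_exp_le_profile k (r₀ := r) le_rfl
  rw [zero_add] at this
  exact (mul_pos (Real.sinh_pos_iff.2 hr) (Real.exp_pos _)).trans_le this

theorem contDiff_profile (k : SignType) : ContDiff ℝ ∞ (profile k) := by
  rcases k with _ | _ | _
  · exact Real.contDiff_exp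
  · exact Real.contDiff_cosh
  · exact Real.contDiff_sinh

theorem lintegral_one_div_profile_lt_top (k : SignType) {r₀ : ℝ} (hr₀ : 0 < r₀) :
    ∫⁻ r in Ioi 0, ENNReal.ofReal (1 / profile k (r + r₀)) < ⊤ := by
  have h1 : IntegrableOn (fun r => (Real.sinh r₀)⁻¹ * Real.exp (-r)) (Ioi 0) :=
    (integrableOn_exp_neg_Ioi 0).const_mul _
  refine lt_of_le_of_lt (setLIntegral_mono' measurableSet_Ioi fun r hr => ?_)
    h1.lintegral_lt_top
  refine ENNReal.ofReal_le_ofReal ?_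
  have hs := Real.sinh_pos_iff.2 hr₀
  rw [Real.exp_neg, ← mul_inv, one_div]
  exact inv_anti₀ (mul_pos hs (Real.exp_pos _)) (sinh_mul_exp_le_profile k (le_of_lt hr))

/-- 2 arctan(e^{-r}) is the tail integral of 1/cosh from r to infinity; its value at 0 is the total
π/2. -/
theorem hasDerivAt_two_arctan_exp_neg (r : ℝ) :
    HasDerivAt (fun r => -(2 * Real.arctan (Real.exp (-r)))) (1 / Real.cosh r) r := by
  have := (((hasDerivAt_neg r).exp).arctan.const_mul 2).neg
  refine this.congr_deriv ?_
  rw [Real.cosh_eq, Real.exp_neg]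
  have := Real.exp_pos r
  field_simp

theorem lintegral_one_div_cosh_le :
    ∫⁻ r in Ioi 0, ENNReal.ofReal (1 / Real.cosh r) ≤ ENNReal.ofReal (Real.pi / 2) := by
  have hlim : Tendsto (fun r => -(2 * Real.arctan (Real.exp (-r)))) atTop (𝓝 0) := by
    have h1 : Tendsto (fun r : ℝ => Real.exp (-r)) atTop (𝓝 0) :=
      Real.tendsto_exp_neg_atTop_nhds_zero
    have h2 := (Real.continuous_arctan.tendsto 0).comp h1
    simpa using (h2.const_mul 2).neg
  have hpos : ∀ r ∈ Ioi (0 : ℝ), 0 ≤ 1 / Real.cosh r := fun r _ =>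
    (one_div_pos.2 (Real.cosh_pos r)).le
  have hint := integrableOn_Ioi_deriv_of_nonneg
    (hasDerivAt_two_arctan_exp_neg 0).continuousAt.continuousWithinAt
    (fun r _ => hasDerivAt_two_arctan_exp_neg r) hpos hlim
  have heq := integral_Ioi_of_hasDerivAt_of_nonneg
    (hasDerivAt_two_arctan_exp_neg 0).continuousAt.continuousWithinAt
    (fun r _ => hasDerivAt_two_arctan_exp_neg r) hpos hlim
  rw [← ofReal_integral_eq_lintegral_ofReal hint
    ((ae_restrict_iff' measurableSet_Ioi).2 (Eventually.of_forall hpos)), heq]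
  refine ENNReal.ofReal_le_ofReal (le_of_eq ?_)
  simp; ring

theorem lintegral_one_div_exp_le :
    ∫⁻ r in Ioi 0, ENNReal.ofReal (1 / Real.exp r) ≤ ENNReal.ofReal 1 := by
  simp only [one_div, ← Real.exp_neg]
  rw [← ofReal_integral_eq_lintegral_ofReal (integrableOn_exp_neg_Ioi 0)
    (Eventually.of_forall fun r => (Real.exp_pos _).le), integral_exp_neg_Ioi_zero]

/-- The inverse `G` of the tail integral `r ↦ ∫_r^∞ 1 / f_k`, on an interval `(0, c)`. -/
theorem exists_inverse_tail (k : SignType) (Λ : ℝ) :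
    ∃ (c : ℝ) (G : ℝ → ℝ), 0 < c ∧
      (ENNReal.ofReal Λ < ∫⁻ r in Ioi 0, ENNReal.ofReal (1 / profile k r) → Λ < c) ∧
      (∀ t ∈ Ioo 0 c, 0 < G t ∧ HasDerivAt G (-profile k (G t)) t ∧ ContDiffAt ℝ ∞ G t) ∧
      Tendsto G (𝓝[>] 0) atTop := by
  have hlog : Tendsto (fun x => -Real.log x) (𝓝[>] 0) atTop :=
    tendsto_neg_atBot_atTop.comp Real.tendsto_log_nhdsGT_zero
  -- The cases come in the order exp, cosh, sinh. The tails e^{-r}, 2 arctan(e^{-r}) and -log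
  -- tanh(r/2) have the inverses -log t, -log tan(t/2) and -log tanh(t/2).
  rcases k with _ | _ | _
  · refine ⟨1, fun t => -Real.log t, one_pos, fun h => ?_, fun t ht => ⟨?_, ?_, ?_⟩, hlog⟩
    · exact (ENNReal.ofReal_lt_ofReal_iff one_pos).1 (h.trans_le lintegral_one_div_exp_le)
    · exact neg_pos.2 (Real.log_neg ht.1 ht.2)
    · refine (Real.hasDerivAt_log ht.1.ne').neg.congr_deriv ?_
      simp [profile, Real.exp_neg, Real.exp_log ht.1]
    · exact (contDiffAt_id.log ht.1.ne').neg
  · have hpi := Real.pi_pos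
    have hcos : ∀ t ∈ Ioo 0 (Real.pi / 2), 0 < Real.cos (t / 2) := fun t ht =>
      Real.cos_pos_of_mem_Ioo ⟨by linarith [ht.1], by linarith [ht.2]⟩
    have htan : ∀ t ∈ Ioo 0 (Real.pi / 2), 0 < Real.tan (t / 2) := fun t ht =>
      Real.tan_pos_of_pos_of_lt_pi_div_two (by linarith [ht.1]) (by linarith [ht.2])
    refine ⟨Real.pi / 2, fun t => -Real.log (Real.tan (t / 2)), by positivity, fun h => ?_,
      fun t ht => ⟨?_, ?_, ?_⟩, hlog.comp ?_⟩
    · exact (ENNReal.ofReal_lt_ofReal_iff (by positivity)).1 (h.trans_le lintegral_one_div_cosh_le)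
    · refine neg_pos.2 (Real.log_neg (htan t ht) ?_)
      rw [← Real.tan_pi_div_four]
      exact Real.tan_lt_tan_of_lt_of_lt_pi_div_two (by linarith [ht.1]) (by linarith)
        (by linarith [ht.2])
    · have h1 : HasDerivAt (fun t => Real.tan (t / 2)) _ t :=
        HasDerivAt.comp t (h := fun t => t / 2) (Real.hasDerivAt_tan (hcos t ht).ne')
          ((hasDerivAt_id t).div_const 2)
      refine (h1.log (htan t ht).ne').neg.congr_deriv ?_
      change _ = -Real.cosh _
      rw [Real.cosh_eq, neg_neg, Real.exp_neg, Real.exp_log (htan t ht)]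
      have h2 := hcos t ht
      have h3 := htan t ht
      rw [Real.tan_eq_sin_div_cos] at h3 ⊢
      have h4 : 0 < Real.sin (t / 2) := by
        have := mul_pos h3 h2
        rwa [div_mul_cancel₀ _ h2.ne'] at this
      have h5 := Real.sin_sq_add_cos_sq (t / 2)
      field_simp
      linarith
    · have h1 : ContDiffAt ℝ ∞ (fun t => Real.tan (t / 2)) t :=
        ContDiffAt.comp (g := Real.tan) (f := fun t => t / 2) t
          (Real.contDiffAt_tan.2 (hcos t ht).ne') (by fun_prop)
      exact (h1.log (htan t ht).ne').neg
    · refine tendsto_nhdsWithin_of_tendsto_nhds_of_eventually_within _ ?_ ?_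
      · have h1 : ContinuousAt (fun t => Real.tan (t / 2)) 0 :=
          (Real.continuousAt_tan.2 (by simp)).comp (f := fun t : ℝ => t / 2) (by fun_prop)
        have := h1.tendsto
        simp only [zero_div, Real.tan_zero] at this
        exact this.mono_left nhdsWithin_le_nhds
      · filter_upwards [Ioo_mem_nhdsGT (show (0 : ℝ) < Real.pi / 2 by positivity)] with t ht
          using htan t ht
  · have hsinh : ∀ t : ℝ, 0 < t → 0 < Real.sinh (t / 2) := fun t ht =>
      Real.sinh_pos_iff.2 (by linarith)
    have hq : ∀ t : ℝ, 0 < t → 0 < Real.sinh (t / 2) / Real.cosh (t / 2) := fun t ht =>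
      div_pos (hsinh t ht) (Real.cosh_pos _)
    have hD : ∀ t : ℝ, HasDerivAt (fun t => Real.sinh (t / 2) / Real.cosh (t / 2))
        ((Real.cosh (t / 2) * (1 / 2) * Real.cosh (t / 2) -
          Real.sinh (t / 2) * (Real.sinh (t / 2) * (1 / 2))) / Real.cosh (t / 2) ^ 2) t := fun t =>
      (((hasDerivAt_id t).div_const 2).sinh).div (((hasDerivAt_id t).div_const 2).cosh)
        (Real.cosh_pos _).ne'
    -- The integral of 1/sinh diverges at 0, so its tail takes all positive values and any c beyond
    -- Λ will do.
    refine ⟨|Λ| + 1, fun t => -Real.log (Real.sinh (t / 2) / Real.cosh (t / 2)), by positivity,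
      fun _ => (le_abs_self Λ).trans_lt (lt_add_one _), fun t ht => ⟨?_, ?_, ?_⟩, hlog.comp ?_⟩
    · refine neg_pos.2 (Real.log_neg (hq t ht.1) ?_)
      rw [div_lt_one (Real.cosh_pos _)]
      exact Real.sinh_lt_cosh _
    · refine ((hD t).log (hq t ht.1).ne').neg.congr_deriv ?_
      change _ = -Real.sinh (-Real.log (Real.sinh (t / 2) / Real.cosh (t / 2)))
      rw [Real.sinh_eq (-_), neg_neg, Real.exp_neg, Real.exp_log (hq t ht.1)]
      have h2 := Real.cosh_pos (t / 2)
      have h4 := hsinh t ht.1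
      have h5 := Real.cosh_sq (t / 2)
      field_simp
    · have h1 : ContDiffAt ℝ ∞ (fun t => Real.sinh (t / 2) / Real.cosh (t / 2)) t :=
        (Real.contDiff_sinh.comp (by fun_prop)).contDiffAt.div
          (Real.contDiff_cosh.comp (by fun_prop)).contDiffAt (Real.cosh_pos _).ne'
      exact (h1.log (hq t ht.1).ne').neg
    · refine tendsto_nhdsWithin_of_tendsto_nhds_of_eventually_within _ ?_ ?_
      · have := (hD 0).continuousAt.tendsto
        simp only [zero_div, Real.sinh_zero] at this
        exact this.mono_left nhdsWithin_le_nhds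
      · filter_upwards [self_mem_nhdsWithin] with t ht using hq t ht

end Profile

/-! ### Solving the equation of the radial change -/

/-- The change of radial variable from `dz² + f² h` to `dr² + f_k(r + r₀)² h`, for integrable
`1 / f`. -/
theorem exists_radial_change {f : ℝ → ℝ} (hf : ContDiffOn ℝ ∞ f (Ici 0))
    (hpos : ∀ z ∈ Ici (0 : ℝ), 0 < f z) (k : SignType)
    (hfin : ∫⁻ s in Ici 0, ENNReal.ofReal (1 / f s) < ⊤) :
    ∃ z₀ : ℝ, 0 ≤ z₀ ∧ (∫⁻ s in Ici 0, ENNReal.ofReal (1 / f s) <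
        ∫⁻ r in Ioi 0, ENNReal.ofReal (1 / profile k r) → z₀ = 0) ∧
      ∃ r₀ : ℝ, 0 < r₀ ∧ ∃ K : ℝ → ℝ, ContDiffOn ℝ ∞ K (Ici z₀) ∧ K z₀ = 0 ∧
        Tendsto K atTop atTop ∧
        ∀ z ∈ Ici z₀, 0 < K z + r₀ ∧
          HasDerivWithinAt K (profile k (K z + r₀) / f z) (Ici z₀) z := by
  obtain ⟨Λ, hΛ, hlim, hlt⟩ := exists_tendsto_recipPrimitive hf.continuousOn hpos hfin
  obtain ⟨c, G, hc, hΛc, hG, hGlim⟩ := exists_inverse_tail k Λ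
  have hT : Tendsto (fun z => Λ - recipPrimitive f z) atTop (𝓝 0) := by
    simpa using hlim.const_sub Λ
  -- The tail Λ - p(z) must lie in the domain (0, c) of G. It tends to 0, so this holds from some z₀
  -- on, and already from 0 if Λ < c.
  obtain ⟨z₀, hz₀, hz₀Λ, hz₀c⟩ : ∃ z₀ : ℝ, 0 ≤ z₀ ∧ (Λ < c → z₀ = 0) ∧
      Λ - recipPrimitive f z₀ < c := by
    by_cases h : Λ < c
    · exact ⟨0, le_rfl, fun _ => rfl, by simpa [recipPrimitive_zero] using h⟩
    · obtain ⟨z₀, h1, h2⟩ := ((hT.eventually (gt_mem_nhds hc)).and (eventually_ge_atTop 0)).exists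
      exact ⟨z₀, h2, fun h' => absurd h' h, h1⟩
  have hTmem : ∀ z ∈ Ici z₀, Λ - recipPrimitive f z ∈ Ioo 0 c := fun z hz =>
    ⟨sub_pos.2 (hlt z), lt_of_le_of_lt (sub_le_sub_left
      ((strictMono_recipPrimitive hf.continuousOn hpos).monotone hz) _) hz₀c⟩
  have hsub : Ici z₀ ⊆ Ici (0 : ℝ) := Ici_subset_Ici.2 hz₀
  -- The value r = G(Λ - p(z)) has the same tail integral for the profile as z has for f.
  -- Subtracting its value r₀ at z₀ makes K start at 0.
  refine ⟨z₀, hz₀, fun h => hz₀Λ (hΛc (by rwa [hΛ])), G (Λ - recipPrimitive f z₀),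
    (hG _ (hTmem z₀ self_mem_Ici)).1,
    fun z => G (Λ - recipPrimitive f z) - G (Λ - recipPrimitive f z₀), ?_, sub_self _, ?_, ?_⟩
  · refine ContDiffOn.sub (fun z hz => ?_) contDiffOn_const
    exact (hG _ (hTmem z hz)).2.2.comp_contDiffWithinAt z
      ((contDiffOn_const.sub (contDiffOn_recipPrimitive hf hpos)).mono hsub z hz)
  · refine tendsto_atTop_add_const_right _ _ (hGlim.comp ?_)
    exact tendsto_nhdsWithin_of_tendsto_nhds_of_eventually_within _ hT
      (Eventually.of_forall fun z => sub_pos.2 (hlt z))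
  · intro z hz
    have h1 := (hasDerivAt_recipPrimitive hf.continuousOn hpos z).const_sub Λ
    have h2 := ((hG _ (hTmem z hz)).2.1.comp z h1).sub_const (G (Λ - recipPrimitive f z₀))
    refine ⟨by simpa using (hG _ (hTmem z hz)).1, h2.hasDerivWithinAt.congr_deriv ?_⟩
    rw [max_eq_left (hsub hz), sub_add_cancel]
    ring

/-- The change of radial variable from `dz² + f² h` to `dz² + e^{-2z} h`, for non-integrable
`1 / f`. -/
theorem exists_radial_change_cusp {f : ℝ → ℝ} (hf : ContDiffOn ℝ ∞ f (Ici 0))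
    (hpos : ∀ z ∈ Ici (0 : ℝ), 0 < f z)
    (hinf : ¬ ∫⁻ s in Ici 0, ENNReal.ofReal (1 / f s) < ⊤) :
    ∃ K : ℝ → ℝ, ContDiffOn ℝ ∞ K (Ici 0) ∧ K 0 = 0 ∧ Tendsto K atTop atTop ∧
      ∀ z ∈ Ici (0 : ℝ), HasDerivWithinAt K (Real.exp (-K z) / f z) (Ici 0) z := by
  have hP : ∀ z ∈ Ici (0 : ℝ), 0 < 1 + recipPrimitive f z := fun z hz => by
    have := (strictMono_recipPrimitive hf.continuousOn hpos).monotone hz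
    rw [recipPrimitive_zero] at this
    linarith
  -- The equation e^K dK = dz / f with K(0) = 0 integrates to e^K = 1 + p.
  refine ⟨fun z => Real.log (1 + recipPrimitive f z), ?_, by simp [recipPrimitive_zero], ?_, ?_⟩
  · exact (contDiffOn_const.add (contDiffOn_recipPrimitive hf hpos)).log fun z hz => (hP z hz).ne'
  · exact Real.tendsto_log_atTop.comp (tendsto_atTop_add_const_left _ _
      (tendsto_recipPrimitive_atTop hf.continuousOn hpos hinf))
  · intro z hz
    have h1 := ((hasDerivAt_recipPrimitive hf.continuousOn hpos z).const_add 1).log (hP z hz).ne'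
    refine h1.hasDerivWithinAt.congr_deriv ?_
    rw [max_eq_left hz, Real.exp_neg, Real.exp_log (hP z hz)]
    field_simp

/-! ### Radial changes of variable are conformal -/

section Radial

set_option linter.unusedSectionVars false

variable {E : Type*} [NormedAddCommGroup E] [NormedSpace ℝ E]
  {H : Type*} [TopologicalSpace H] {I : ModelWithCorners ℝ E H}
  {N : Type*} [TopologicalSpace N] [ChartedSpace H N] [IsManifold I ∞ N]

theorem warped_apply (f : ℝ → ℝ) (h : SmoothMetric I N) (p : ℝ × N) (v w : ℝ × E) :
    warped f h p (show TangentSpace (𝓘(ℝ, ℝ).prod I) p from v) (show TangentSpace _ p from w) =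
      v.1 * w.1 + f p.1 ^ 2 * h.inner p.2 (show TangentSpace I p.2 from v.2)
        (show TangentSpace I p.2 from w.2) := by
  simp only [warped, mfderiv_fst, mfderiv_snd]
  rfl

theorem uniqueMDiffOn_halfCyl (a : ℝ) : UniqueMDiffOn (𝓘(ℝ, ℝ).prod I) (halfCyl N a) :=
  (uniqueDiffOn_Ici a).uniqueMDiffOn.prod uniqueMDiffOn_univ

theorem contMDiffOn_prodMap_id {a : ℝ} {K : ℝ → ℝ} (hK : ContDiffOn ℝ ∞ K (Ici a)) :
    ContMDiffOn (𝓘(ℝ, ℝ).prod I) (𝓘(ℝ, ℝ).prod I) ∞ (Prod.map K (id : N → N)) (halfCyl N a) :=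
  hK.contMDiffOn.prodMap contMDiffOn_id

theorem bijOn_prodMap_id {a b : ℝ} {K : ℝ → ℝ} (hK : BijOn K (Ici a) (Ici b)) :
    BijOn (Prod.map K (id : N → N)) (halfCyl N a) (halfCyl N b) := by
  refine ⟨fun p hp => ⟨hK.mapsTo hp.1, mem_univ _⟩, fun p hp q hq hpq => ?_, fun q hq => ?_⟩
  · exact Prod.ext (hK.injOn hp.1 hq.1 (congrArg Prod.fst hpq)) (congrArg Prod.snd hpq :)
  · obtain ⟨z, hz, hzq⟩ := hK.surjOn hq.1
    exact ⟨(z, q.2), ⟨hz, mem_univ _⟩, Prod.ext hzq rfl⟩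

/-- The pullback is K'² dz² + g(K)² h, which equals K'² (dz² + f² h) because g∘K = K' f; the
conformal factor is K'². -/
theorem isConformalDiffeoOn_prodMap_id (h : SmoothMetric I N) {a b : ℝ} {f g K K' : ℝ → ℝ}
    (hK : ContDiffOn ℝ ∞ K (Ici a)) (hab : K a = b) (hlim : Tendsto K atTop atTop)
    (hK' : ∀ z ∈ Ici a, HasDerivWithinAt K (K' z) (Ici a) z) (hpos : ∀ z ∈ Ici a, 0 < K' z)
    (hfg : ∀ z ∈ Ici a, g (K z) = K' z * f z) :
    IsConformalDiffeoOn (𝓘(ℝ, ℝ).prod I) (warped f h) (halfCyl N a) (warped g h) (halfCyl N b)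
      (Prod.map K id) := by
  obtain ⟨L, hbij, hinv, hL⟩ := exists_smooth_inverse_Ici hK hK' hpos hab hlim
  refine ⟨bijOn_prodMap_id hbij, contMDiffOn_prodMap_id hK, ⟨Prod.map L id, ⟨?_, ?_⟩,
    contMDiffOn_prodMap_id hL⟩, fun p => K' p.1 ^ 2, ?_, fun p hp => pow_pos (hpos _ hp.1) 2, ?_⟩
  · exact fun p hp => Prod.ext (hinv.1 hp.1) rfl
  · exact fun p hp => Prod.ext (hinv.2 hp.1) rfl
  · have h1 : ContDiffOn ℝ ∞ K' (Ici a) :=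
      (hK.derivWithin (uniqueDiffOn_Ici a) (m := ∞) (by simp)).congr fun z hz =>
        ((hK' z hz).derivWithin (uniqueDiffOn_Ici a z hz)).symm
    exact (h1.pow 2).contMDiffOn.comp contMDiffOn_fst fun p hp => hp.1
  · intro p hp v w
    have h1 : HasMFDerivWithinAt 𝓘(ℝ, ℝ) 𝓘(ℝ, ℝ) K (Ici a) p.1
        (ContinuousLinearMap.toSpanSingleton ℝ (K' p.1)) :=
      (hK' p.1 hp.1).hasFDerivWithinAt.hasMFDerivWithinAt
    have h2 : HasMFDerivWithinAt I I (id : N → N) univ p.2 (ContinuousLinearMap.id ℝ _) :=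
      (hasMFDerivAt_id p.2).hasMFDerivWithinAt
    have hS : Prod.fst '' halfCyl N a ⊆ Ici a := image_subset_iff.2 fun q hq => hq.1
    have h3 := ((h1.mono hS).prodMap (h2.mono (subset_univ _))).mfderivWithin
      (uniqueMDiffOn_halfCyl a p hp)
    rw [h3]
    have e := warped_apply g h (Prod.map K id p) (v.1 * K' p.1, v.2) (w.1 * K' p.1, w.2)
    have e' := warped_apply f h p v w
    refine Eq.trans e ?_
    refine Eq.trans ?_ (congrArg (K' p.1 ^ 2 * ·) e').symm
    simp only [Prod.map_fst, Prod.map_snd, id, hfg p.1 hp.1]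
    ring

end Radial

/-! ### Completeness of the cusp -/

section Completeness

set_option linter.unusedSectionVars false

variable {E : Type*} [NormedAddCommGroup E] [NormedSpace ℝ E]
  {H : Type*} [TopologicalSpace H] {I : ModelWithCorners ℝ E H}
  {N : Type*} [TopologicalSpace N] [ChartedSpace H N] [IsManifold I ∞ N]

/-- The field of bilinear forms of a smooth metric. -/
noncomputable abbrev SmoothMetric.toField (h : SmoothMetric I N) : MetricField I N :=
  fun q v w => h.inner q v w

open scoped Bundle in
theorem riemannianDistOn_univ_eq (h : SmoothMetric I N) (x y : N) :
    letI : Bundle.RiemannianBundle (fun x : N => TangentSpace I x) := ⟨h.toRiemannianMetric⟩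
    riemannianDistOn I h.toField univ x y = Manifold.riemannianEDist I x y := by
  let : Bundle.RiemannianBundle (fun x : N => TangentSpace I x) := ⟨h.toRiemannianMetric⟩
  have hlen : ∀ γ : ℝ → N, pathLength I h.toField γ = Manifold.pathELength I γ 0 1 := by
    intro γ
    rw [Manifold.pathELength_eq_lintegral_mfderivWithin_Icc, pathLength]
    refine lintegral_congr fun t => ?_
    rw [← ofReal_norm, norm_eq_sqrt_real_inner]
    rfl
  refine le_antisymm (le_of_forall_gt fun r hr => ?_) ?_
  · obtain ⟨γ, h0, h1, hγ, hlt⟩ := Manifold.exists_lt_of_riemannianEDist_lt hr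
    simp only [riemannianDistOn, iInf_lt_iff]
    exact ⟨γ, hγ, mapsTo_univ _ _, h0, h1, by rwa [hlen]⟩
  · simp only [riemannianDistOn, le_iInf_iff]
    intro γ hγ _ h0 h1
    rw [hlen]
    exact Manifold.riemannianEDist_le_pathELength hγ h0 h1 zero_le_one

-- The Riemannian distance induces the given topology of N, and compactness for that topology makes
-- every Cauchy sequence converge.
open scoped Bundle in
theorem isCompleteOn_univ_of_compactSpace [CompactSpace N] [T2Space N] (h : SmoothMetric I N) :
    IsCompleteOn I h.toField univ := by
  let : Bundle.RiemannianBundle (fun x : N => TangentSpace I x) := ⟨h.toRiemannianMetric⟩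
  have : IsContinuousRiemannianBundle E (fun x : N => TangentSpace I x) :=
    ⟨⟨h.inner, h.contMDiff.continuous, fun _ _ _ => rfl⟩⟩
  have : IsManifold I 1 N := IsManifold.of_le (n := ∞) (by simp)
  let : PseudoEMetricSpace N := .ofRiemannianMetric I N
  intro x _ hx
  have hd : ∀ p q : N, riemannianDistOn I h.toField univ p q = edist p q := fun p q =>
    riemannianDistOn_univ_eq h p q
  simp only [hd] at hx ⊢
  have hc : CauchySeq x := by
    refine EMetric.cauchySeq_iff.2 fun ε hε => ?_
    obtain ⟨n₀, h0⟩ := hx ε hε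
    exact ⟨n₀, fun m hm n hn => h0 m hm n hn⟩
  obtain ⟨p, hp⟩ := cauchySeq_tendsto_of_complete hc
  exact ⟨p, mem_univ _, tendsto_iff_edist_tendsto_0.1 hp⟩

theorem warped_mfderivWithin_path (f : ℝ → ℝ) (h : SmoothMetric I N) {γ : ℝ → ℝ × N}
    (hγ : ContMDiffOn 𝓘(ℝ, ℝ) (𝓘(ℝ, ℝ).prod I) 1 γ (Icc 0 1)) {t : ℝ} (ht : t ∈ Icc (0 : ℝ) 1) :
    warped f h (γ t) (mfderivWithin 𝓘(ℝ, ℝ) (𝓘(ℝ, ℝ).prod I) γ (Icc 0 1) t (1 : ℝ))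
        (mfderivWithin 𝓘(ℝ, ℝ) (𝓘(ℝ, ℝ).prod I) γ (Icc 0 1) t (1 : ℝ)) =
      derivWithin (fun s => (γ s).1) (Icc 0 1) t ^ 2 + f (γ t).1 ^ 2 *
        h.toField (γ t).2 (mfderivWithin 𝓘(ℝ, ℝ) I (fun s => (γ s).2) (Icc 0 1) t (1 : ℝ))
          (mfderivWithin 𝓘(ℝ, ℝ) I (fun s => (γ s).2) (Icc 0 1) t (1 : ℝ)) := by
  have hd := (hγ t ht).mdifferentiableWithinAt one_ne_zero
  have h1 : MDifferentiableWithinAt 𝓘(ℝ, ℝ) 𝓘(ℝ, ℝ) (fun s => (γ s).1) (Icc 0 1) t := hd.fst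
  have h2 : MDifferentiableWithinAt 𝓘(ℝ, ℝ) I (fun s => (γ s).2) (Icc 0 1) t := hd.snd
  have e := mfderivWithin_prodMk h1 h2 ((uniqueDiffOn_Icc zero_lt_one).uniqueMDiffOn t ht)
  have e1 : mfderivWithin 𝓘(ℝ, ℝ) (𝓘(ℝ, ℝ).prod I) γ (Icc 0 1) t (1 : ℝ) =
      (derivWithin (fun s => (γ s).1) (Icc 0 1) t,
        mfderivWithin 𝓘(ℝ, ℝ) I (fun s => (γ s).2) (Icc 0 1) t (1 : ℝ)) := by
    refine (congrArg (fun L => L (1 : ℝ)) e).trans ?_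
    rw [mfderivWithin_eq_fderivWithin]
    rfl
  rw [e1]
  refine (warped_apply f h (γ t) _ _).trans ?_
  rw [sq (derivWithin _ _ _)]

theorem toField_self_nonneg (h : SmoothMetric I N) (q : N) (v : TangentSpace I q) :
    0 ≤ h.toField q v v := by
  rcases eq_or_ne v 0 with rfl | hv
  · simp
  · exact (h.pos q v hv).le

theorem contDiffOn_fst_path {γ : ℝ → ℝ × N}
    (hγ : ContMDiffOn 𝓘(ℝ, ℝ) (𝓘(ℝ, ℝ).prod I) 1 γ (Icc 0 1)) :
    ContDiffOn ℝ 1 (fun s => (γ s).1) (Icc 0 1) :=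
  contMDiffOn_iff_contDiffOn.1 (contMDiff_fst.comp_contMDiffOn hγ)

theorem edist_fst_le_pathLength (f : ℝ → ℝ) (h : SmoothMetric I N) {γ : ℝ → ℝ × N}
    (hγ : ContMDiffOn 𝓘(ℝ, ℝ) (𝓘(ℝ, ℝ).prod I) 1 γ (Icc 0 1)) {t : ℝ} (ht : t ∈ Icc (0 : ℝ) 1) :
    edist (γ 0).1 (γ t).1 ≤ pathLength (𝓘(ℝ, ℝ).prod I) (warped f h) γ := by
  have hc := (contDiffOn_fst_path hγ).mono (Icc_subset_Icc_right ht.2)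
  rw [edist_comm, edist_eq_enorm_sub]
  refine (enorm_sub_le_lintegral_deriv_of_contDiffOn_Icc hc ht.1).trans ?_
  refine (lintegral_mono_set (Icc_subset_Icc_right ht.2)).trans ?_
  rw [pathLength, ← restrict_Ioo_eq_restrict_Icc]
  refine setLIntegral_mono' measurableSet_Ioo fun s hs => ?_
  rw [warped_mfderivWithin_path f h hγ (Ioo_subset_Icc_self hs),
    derivWithin_of_mem_nhds (Icc_mem_nhds hs.1 hs.2), ← ofReal_norm, Real.norm_eq_abs]
  refine ENNReal.ofReal_le_ofReal (Real.abs_le_sqrt ?_)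
  have := toField_self_nonneg h (γ s).2
    (mfderivWithin 𝓘(ℝ, ℝ) I (fun s => (γ s).2) (Icc 0 1) s (1 : ℝ))
  nlinarith [sq_nonneg (f (γ s).1)]

theorem mul_pathLength_snd_le (f : ℝ → ℝ) (h : SmoothMetric I N) {γ : ℝ → ℝ × N} {c : ℝ}
    (hγ : ContMDiffOn 𝓘(ℝ, ℝ) (𝓘(ℝ, ℝ).prod I) 1 γ (Icc 0 1)) (hc : 0 ≤ c)
    (hcf : ∀ t ∈ Icc (0 : ℝ) 1, c ≤ f (γ t).1) :
    ENNReal.ofReal c * pathLength I h.toField (fun s => (γ s).2) ≤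
      pathLength (𝓘(ℝ, ℝ).prod I) (warped f h) γ := by
  rw [pathLength, pathLength, ← lintegral_const_mul' _ _ ENNReal.ofReal_ne_top]
  refine setLIntegral_mono' measurableSet_Icc fun s hs => ?_
  rw [warped_mfderivWithin_path f h hγ hs, ← ENNReal.ofReal_mul hc]
  refine ENNReal.ofReal_le_ofReal (Real.le_sqrt_of_sq_le ?_)
  have h0 := toField_self_nonneg h (γ s).2
    (mfderivWithin 𝓘(ℝ, ℝ) I (fun s => (γ s).2) (Icc 0 1) s (1 : ℝ))
  rw [mul_pow, Real.sq_sqrt h0]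
  have h2 : c ^ 2 ≤ f (γ s).1 ^ 2 := pow_le_pow_left₀ hc (hcf s hs) 2
  nlinarith [sq_nonneg (derivWithin (fun s => (γ s).1) (Icc 0 1) s)]

/-- Traverse the radial segment and a nearly shortest curve of the base simultaneously: with radial
speed a and base speed b, √(a² + f² b²) ≤ |a| + b as f² ≤ 1. -/
theorem riemannianDistOn_halfCyl_le {f : ℝ → ℝ} (h : SmoothMetric I N) {a : ℝ}
    (hf : ∀ z ∈ Ici a, f z ^ 2 ≤ 1) {p q : ℝ × N} (hp : p ∈ halfCyl N a) (hq : q ∈ halfCyl N a) :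
    riemannianDistOn (𝓘(ℝ, ℝ).prod I) (warped f h) (halfCyl N a) p q ≤
      edist p.1 q.1 + riemannianDistOn I h.toField univ p.2 q.2 := by
  refine ENNReal.le_of_forall_pos_le_add fun ε hε hfin => ?_
  have hlt : riemannianDistOn I h.toField univ p.2 q.2 <
      riemannianDistOn I h.toField univ p.2 q.2 + ε :=
    ENNReal.lt_add_right (ENNReal.add_lt_top.1 hfin).2.ne (by exact_mod_cast hε.ne')
  rw [add_assoc]
  generalize riemannianDistOn I h.toField univ p.2 q.2 + ε = r at hlt
  simp only [riemannianDistOn, iInf_lt_iff] at hlt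
  obtain ⟨γ, hγ, -, h0, h1, hr⟩ := hlt
  have hl : ∀ t, HasDerivAt (fun t : ℝ => p.1 + t * (q.1 - p.1)) (q.1 - p.1) t := fun t => by
    simpa using ((hasDerivAt_id t).mul_const (q.1 - p.1)).const_add p.1
  have hη : ContMDiffOn 𝓘(ℝ, ℝ) (𝓘(ℝ, ℝ).prod I) 1
      (fun t : ℝ => (p.1 + t * (q.1 - p.1), γ t)) (Icc 0 1) := by
    refine ContMDiffOn.prodMk ?_ hγ
    exact contMDiffOn_iff_contDiffOn.2 (by fun_prop)
  have hS : MapsTo (fun t : ℝ => (p.1 + t * (q.1 - p.1), γ t)) (Icc 0 1) (halfCyl N a) := by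
    intro t ht
    refine ⟨?_, mem_univ _⟩
    have hp1 : a ≤ p.1 := hp.1
    have hq1 : a ≤ q.1 := hq.1
    change a ≤ p.1 + t * (q.1 - p.1)
    nlinarith [ht.1, ht.2]
  have hle : riemannianDistOn (𝓘(ℝ, ℝ).prod I) (warped f h) (halfCyl N a) p q ≤
      pathLength (𝓘(ℝ, ℝ).prod I) (warped f h) (fun t : ℝ => (p.1 + t * (q.1 - p.1), γ t)) :=
    iInf₂_le_of_le _ hη (iInf₂_le_of_le hS (by simp [h0]) (iInf_le _ (by simp [h1])))
  refine hle.trans ?_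
  have hlen : pathLength (𝓘(ℝ, ℝ).prod I) (warped f h)
      (fun t : ℝ => (p.1 + t * (q.1 - p.1), γ t)) ≤
      ∫⁻ t in Icc (0 : ℝ) 1, (edist p.1 q.1 + ENNReal.ofReal
        (√ (h.toField (γ t) (mfderivWithin 𝓘(ℝ, ℝ) I γ (Icc 0 1) t (1 : ℝ))
          (mfderivWithin 𝓘(ℝ, ℝ) I γ (Icc 0 1) t (1 : ℝ))))) := by
    refine setLIntegral_mono' measurableSet_Icc fun t ht => ?_
    rw [warped_mfderivWithin_path f h hη ht, (hl t).hasDerivWithinAt.derivWithin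
      (uniqueDiffOn_Icc zero_lt_one t ht), edist_comm, edist_dist, Real.dist_eq,
      ← ENNReal.ofReal_add (abs_nonneg _) (Real.sqrt_nonneg _)]
    refine ENNReal.ofReal_le_ofReal ?_
    have h0 := toField_self_nonneg h (γ t) (mfderivWithin 𝓘(ℝ, ℝ) I γ (Icc 0 1) t (1 : ℝ))
    have h2 := hf _ (hS ht).1
    simp only at h2
    refine Real.sqrt_le_iff.2 ⟨by positivity, ?_⟩
    rw [add_sq, sq_abs, Real.sq_sqrt h0]
    have h3 : 0 ≤ 2 * |q.1 - p.1| *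
      √ (h.toField (γ t) (mfderivWithin 𝓘(ℝ, ℝ) I γ (Icc 0 1) t (1 : ℝ))
          (mfderivWithin 𝓘(ℝ, ℝ) I γ (Icc 0 1) t (1 : ℝ))) := by positivity
    have h4 := mul_le_mul_of_nonneg_right h2 h0
    linarith
  refine hlen.trans ?_
  rw [lintegral_add_left measurable_const]
  simp only [lintegral_const, Measure.restrict_apply MeasurableSet.univ, univ_inter,
    Real.volume_Icc, sub_zero, ENNReal.ofReal_one, mul_one]
  exact add_le_add_right hr.le _

theorem edist_fst_le_riemannianDistOn (f : ℝ → ℝ) (h : SmoothMetric I N) (S : Set (ℝ × N))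
    (p q : ℝ × N) :
    edist p.1 q.1 ≤ riemannianDistOn (𝓘(ℝ, ℝ).prod I) (warped f h) S p q := by
  simp only [riemannianDistOn, le_iInf_iff]
  rintro γ hγ - rfl rfl
  exact edist_fst_le_pathLength f h hγ ⟨zero_le_one, le_rfl⟩

/-- At distances less than one, the distance of the base is controlled by the distance of the
cusp. -/
theorem riemannianDistOn_snd_le (h : SmoothMetric I N) {S : Set (ℝ × N)} {p q : ℝ × N} {Z : ℝ}
    (hZ : p.1 + 1 ≤ Z)
    (hpq : riemannianDistOn (𝓘(ℝ, ℝ).prod I) (warped (fun z => Real.exp (-z)) h) S p q < 1) :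
    ENNReal.ofReal (Real.exp (-Z)) * riemannianDistOn I h.toField univ p.2 q.2 ≤
      riemannianDistOn (𝓘(ℝ, ℝ).prod I) (warped (fun z => Real.exp (-z)) h) S p q := by
  refine le_of_forall_gt fun r hr => ?_
  have hlt := lt_min hr hpq
  simp only [riemannianDistOn, iInf_lt_iff] at hlt
  obtain ⟨γ, hγ, -, rfl, rfl, hlen⟩ := hlt
  -- A path shorter than 1 never rises above height p.1 + 1 ≤ Z, where the warping factor is at
  -- least e^{-Z}.
  have hb : ∀ t ∈ Icc (0 : ℝ) 1, Real.exp (-Z) ≤ Real.exp (-(γ t).1) := by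
    intro t ht
    refine Real.exp_le_exp.2 (neg_le_neg ?_)
    have h1 := (edist_fst_le_pathLength _ h hγ ht).trans_lt (hlen.trans_le (min_le_right _ _))
    rw [edist_dist, ENNReal.ofReal_lt_one, Real.dist_eq] at h1
    linarith [(abs_lt.1 h1).1]
  refine lt_of_le_of_lt ?_ (hlen.trans_le (min_le_left _ _))
  refine le_trans ?_ (mul_pathLength_snd_le _ h hγ (Real.exp_pos _).le hb)
  gcongr
  exact iInf₂_le_of_le _ (contMDiff_snd.comp_contMDiffOn hγ)
    (iInf₂_le_of_le (mapsTo_univ _ _) rfl (iInf_le _ rfl))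

/-- Radial differences are bounded by distances, so the heights converge and are bounded by some B.
Below B + 1 the warping factor is at least e^{-(B+1)}, hence the base components are Cauchy. The
warping factor is also at most 1, so convergence of both components gives convergence in the cusp.
-/
theorem isCompleteOn_cusp [CompactSpace N] [T2Space N] (h : SmoothMetric I N) :
    IsCompleteOn (𝓘(ℝ, ℝ).prod I) (warped (fun z => Real.exp (-z)) h) (halfCyl N 0) := by
  intro x hxS hx
  obtain ⟨n₀, hn₀⟩ := hx 1 one_pos
  have hcauchy : CauchySeq fun n => (x n).1 := by
    refine EMetric.cauchySeq_iff.2 fun ε hε => ?_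
    obtain ⟨n₁, h1⟩ := hx ε hε
    exact ⟨n₁, fun m hm n hn => (edist_fst_le_riemannianDistOn _ h _ _ _).trans_lt (h1 m hm n hn)⟩
  obtain ⟨z, hz⟩ := cauchySeq_tendsto_of_complete hcauchy
  have hz0 : z ∈ Ici (0 : ℝ) := isClosed_Ici.mem_of_tendsto hz (Eventually.of_forall fun n =>
    (hxS n).1)
  obtain ⟨B, hB⟩ := hz.bddAbove_range
  have hexp := ENNReal.ofReal_pos.2 (Real.exp_pos (-(B + 1)))
  obtain ⟨q, -, hq⟩ := isCompleteOn_univ_of_compactSpace h (fun n => (x n).2)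
    (fun _ => mem_univ _) fun ε hε => by
      obtain ⟨n₁, h1⟩ := hx (ENNReal.ofReal (Real.exp (-(B + 1))) * ε)
        (ENNReal.mul_pos hexp.ne' hε.ne')
      refine ⟨max n₀ n₁, fun m hm n hn => ?_⟩
      have hd := (riemannianDistOn_snd_le h (Z := B + 1) (by
        have := hB (mem_range_self m); linarith)
        (hn₀ m (le_of_max_le_left hm) n (le_of_max_le_left hn))).trans_lt
        (h1 m (le_of_max_le_right hm) n (le_of_max_le_right hn))
      exact (ENNReal.mul_lt_mul_iff_right hexp.ne' ENNReal.ofReal_ne_top).1 hd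
  refine ⟨(z, q), ⟨hz0, mem_univ _⟩, ?_⟩
  have hlim := (tendsto_iff_edist_tendsto_0.1 hz).add hq
  rw [add_zero] at hlim
  refine tendsto_of_tendsto_of_tendsto_of_le_of_le tendsto_const_nhds hlim
    (fun _ => zero_le) fun n => riemannianDistOn_halfCyl_le h (fun z hz => ?_) (hxS n)
      ⟨hz0, mem_univ _⟩
  rw [← Real.exp_nat_mul]
  exact Real.exp_le_one_iff.2 (by have : (0 : ℝ) ≤ z := hz; push_cast; linarith)

end Completeness

/-! ### Determinants of warped bilinear forms -/

section WarpForm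

variable {E : Type*} [NormedAddCommGroup E] [NormedSpace ℝ E]

/-- The bilinear form `dz² + c² H` on `ℝ × E`. -/
noncomputable def warpForm (c : ℝ) (H : LinearMap.BilinForm ℝ E) : LinearMap.BilinForm ℝ (ℝ × E) :=
  LinearMap.BilinForm.comp (LinearMap.mul ℝ ℝ) (LinearMap.fst ℝ ℝ E) (LinearMap.fst ℝ ℝ E) +
    c ^ 2 • LinearMap.BilinForm.comp H (LinearMap.snd ℝ ℝ E) (LinearMap.snd ℝ ℝ E)

theorem warpForm_apply (c : ℝ) (H : LinearMap.BilinForm ℝ E) (v w : ℝ × E) :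
    warpForm c H v w = v.1 * w.1 + c ^ 2 * H v.2 w.2 := rfl

/-- The basis of `ℝ × E` obtained from a basis of `E`. -/
noncomputable def prodBasis {κ : Type*} (b : Module.Basis κ ℝ E) :
    Module.Basis (Unit ⊕ κ) ℝ (ℝ × E) :=
  (Module.Basis.singleton Unit ℝ).prod b

theorem det_toMatrix_warpForm {κ : Type*} [Fintype κ] [DecidableEq κ] (b : Module.Basis κ ℝ E)
    (c : ℝ) (H : LinearMap.BilinForm ℝ E) :
    (LinearMap.BilinForm.toMatrix (prodBasis b) (warpForm c H)).det =
      c ^ (2 * Fintype.card κ) * (LinearMap.BilinForm.toMatrix b H).det := by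
  have : LinearMap.BilinForm.toMatrix (prodBasis b) (warpForm c H) =
      Matrix.fromBlocks 1 0 0 (c ^ 2 • LinearMap.BilinForm.toMatrix b H) := by
    ext i j
    rcases i with i | i <;> rcases j with j | j <;>
      simp [LinearMap.BilinForm.toMatrix_apply, warpForm_apply, prodBasis]
  rw [this, Matrix.det_fromBlocks_zero₂₁, Matrix.det_one, one_mul, Matrix.det_smul, pow_mul]

/-- The factor a is the determinant of the change of basis, the same for every form. It relates the
basis `Module.finBasis ℝ (ℝ × E)` of the volume to the product basis, in which warped forms are
block diagonal. -/
theorem exists_det_toMatrix_eq {V : Type*} [AddCommGroup V] [Module ℝ V] {ι κ : Type*} [Fintype ι]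
    [DecidableEq ι] [Fintype κ] [DecidableEq κ] (b : Module.Basis ι ℝ V)
    (b' : Module.Basis κ ℝ V) :
    ∃ a : ℝ, ∀ B : LinearMap.BilinForm ℝ V,
      (LinearMap.BilinForm.toMatrix b B).det = a ^ 2 * (LinearMap.BilinForm.toMatrix b' B).det := by
  set e := b'.indexEquiv b
  refine ⟨((b'.reindex e).toMatrix b).det, fun B => ?_⟩
  rw [← LinearMap.BilinForm.toMatrix_mul_basis_toMatrix (b'.reindex e) b B, Matrix.det_mul,
    Matrix.det_mul, Matrix.det_transpose]
  have : LinearMap.BilinForm.toMatrix (b'.reindex e) B =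
      (LinearMap.BilinForm.toMatrix b' B).submatrix e.symm e.symm := by
    ext i j
    simp [LinearMap.BilinForm.toMatrix_apply]
  rw [this, Matrix.det_submatrix_equiv_self]
  ring

theorem det_toMatrix_comp {V : Type*} [AddCommGroup V] [Module ℝ V] {ι : Type*} [Fintype ι]
    [DecidableEq ι] (b : Module.Basis ι ℝ V) (B : LinearMap.BilinForm ℝ V) (L : V →ₗ[ℝ] V) :
    (LinearMap.BilinForm.toMatrix b (B.comp L L)).det =
      LinearMap.det L ^ 2 * (LinearMap.BilinForm.toMatrix b B).det := by
  rw [LinearMap.BilinForm.toMatrix_comp b b, Matrix.det_mul, Matrix.det_mul, Matrix.det_transpose,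
    LinearMap.det_toMatrix]
  ring

end WarpForm

/-! ### The metric of the base in charts -/

section ChartForm

set_option linter.unusedSectionVars false

variable {E : Type*} [NormedAddCommGroup E] [NormedSpace ℝ E]
  {H : Type*} [TopologicalSpace H] {I : ModelWithCorners ℝ E H} [I.Boundaryless]
  {N : Type*} [TopologicalSpace N] [ChartedSpace H N] [IsManifold I ∞ N]

/-- The metric `h` in the chart centred at `c`, as a bilinear form on the model space. -/
noncomputable def chartForm (h : SmoothMetric I N) (c : N) (y : E) : LinearMap.BilinForm ℝ E :=
  LinearMap.mk₂ ℝ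
    (fun a b => h.inner ((extChartAt I c).symm y)
      (mfderiv 𝓘(ℝ, E) I (extChartAt I c).symm y a) (mfderiv 𝓘(ℝ, E) I (extChartAt I c).symm y b))
    (fun a b d => by
      rw [show mfderiv 𝓘(ℝ, E) I (extChartAt I c).symm y (a + b) = _ from
        map_add (mfderiv 𝓘(ℝ, E) I (extChartAt I c).symm y) a b, map_add]; rfl)
    (fun r a b => by
      rw [show mfderiv 𝓘(ℝ, E) I (extChartAt I c).symm y (r • a) = _ from
        map_smul (mfderiv 𝓘(ℝ, E) I (extChartAt I c).symm y) r a, map_smul]; rfl)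
    (fun a b d => by
      rw [show mfderiv 𝓘(ℝ, E) I (extChartAt I c).symm y (b + d) = _ from
        map_add (mfderiv 𝓘(ℝ, E) I (extChartAt I c).symm y) b d, map_add]; rfl)
    (fun r a b => by
      rw [show mfderiv 𝓘(ℝ, E) I (extChartAt I c).symm y (r • b) = _ from
        map_smul (mfderiv 𝓘(ℝ, E) I (extChartAt I c).symm y) r b, map_smul]; rfl)

theorem chartForm_apply (h : SmoothMetric I N) (c : N) (y a b : E) :
    chartForm h c y a b = h.inner ((extChartAt I c).symm y)
      (mfderiv 𝓘(ℝ, E) I (extChartAt I c).symm y a)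
      (mfderiv 𝓘(ℝ, E) I (extChartAt I c).symm y b) := rfl

theorem chartForm_self_nonneg (h : SmoothMetric I N) (c : N) (y a : E) :
    0 ≤ chartForm h c y a a :=
  toField_self_nonneg h _ _

theorem mdifferentiableAt_extChartAt_symm {c : N} {y : E} (hy : y ∈ (extChartAt I c).target) :
    MDifferentiableAt 𝓘(ℝ, E) I (extChartAt I c).symm y :=
  ((contMDiffOn_extChartAt_symm (n := ∞) c).contMDiffAt
    ((isOpen_extChartAt_target c).mem_nhds hy)).mdifferentiableAt (by simp)

/-- The derivative of the chart is a left inverse. This is what makes the metric in coordinates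
positive definite. -/
theorem mfderiv_extChartAt_symm_injective {c : N} {y : E} (hy : y ∈ (extChartAt I c).target) :
    Function.Injective (mfderiv 𝓘(ℝ, E) I (extChartAt I c).symm y) := by
  have h1 := mdifferentiableAt_extChartAt_symm hy
  have h2 : MDifferentiableAt I 𝓘(ℝ, E) (extChartAt I c) ((extChartAt I c).symm y) := by
    have := (extChartAt I c).map_target hy
    rw [extChartAt_source] at this
    exact mdifferentiableAt_extChartAt this
  have h3 := h2.hasMFDerivAt.comp y h1.hasMFDerivAt
  have h4 : (extChartAt I c) ∘ (extChartAt I c).symm =ᶠ[𝓝 y] id := by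
    filter_upwards [(isOpen_extChartAt_target (I := I) c).mem_nhds hy] with z hz
      using (extChartAt I c).right_inv hz
  have h5 := hasMFDerivAt_unique (h3.congr_of_eventuallyEq h4.symm) (hasMFDerivAt_id y)
  refine Function.LeftInverse.injective (g := mfderiv I 𝓘(ℝ, E) (extChartAt I c)
    ((extChartAt I c).symm y)) fun v => ?_
  exact congrArg (fun L => L v) h5

-- Constant coordinate vectors pushed forward by the inverse chart are continuous sections of the
-- tangent bundle along it, and the inner product of two such sections is continuous.
open scoped Bundle in
theorem continuousOn_chartForm (h : SmoothMetric I N) (c : N) (a b : E) :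
    ContinuousOn (fun y => chartForm h c y a b) (extChartAt I c).target := by
  let : Bundle.RiemannianBundle (fun x : N => TangentSpace I x) := ⟨h.toRiemannianMetric⟩
  have : IsContinuousRiemannianBundle E (fun x : N => TangentSpace I x) :=
    ⟨⟨h.inner, h.contMDiff.continuous, fun _ _ _ => rfl⟩⟩
  have hU := isOpen_extChartAt_target (I := I) c
  have hsec : ∀ a : E, ContinuousOn (fun y => (Bundle.TotalSpace.mk' E ((extChartAt I c).symm y)
      (mfderiv 𝓘(ℝ, E) I (extChartAt I c).symm y a) : TangentBundle I N))
      (extChartAt I c).target := by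
    intro a
    have h1 := (contMDiffOn_extChartAt_symm (I := I) (n := ∞) c).continuousOn_tangentMapWithin
      (by simp) hU.uniqueMDiffOn
    have h2 : Continuous fun y : E => (⟨y, a⟩ : TangentBundle 𝓘(ℝ, E) E) :=
      (tangentBundleModelSpaceHomeomorph 𝓘(ℝ, E)).symm.continuous.comp
        (Continuous.prodMk continuous_id continuous_const)
    refine (h1.comp h2.continuousOn fun y hy => hy).congr fun y hy => ?_
    simp only [Function.comp, tangentMapWithin]
    rw [mfderivWithin_of_mem_nhds (hU.mem_nhds hy)]
  exact (hsec a).inner_bundle (hsec b)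

variable [FiniteDimensional ℝ E]

theorem det_chartForm_pos (h : SmoothMetric I N) {c : N} {y : E}
    (hy : y ∈ (extChartAt I c).target) :
    0 < (LinearMap.BilinForm.toMatrix (Module.finBasis ℝ E) (chartForm h c y)).det := by
  refine Matrix.PosDef.det_pos (Matrix.PosDef.of_dotProduct_mulVec_pos ?_ fun x hx => ?_)
  · ext i j
    simp only [Matrix.conjTranspose_apply, LinearMap.BilinForm.toMatrix_apply, star_trivial,
      chartForm_apply]
    exact h.symm _ _ _
  · rw [star_trivial, LinearMap.BilinForm.dotProduct_toMatrix_mulVec, chartForm_apply]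
    refine h.pos _ _ fun h0 => hx ?_
    have := mfderiv_extChartAt_symm_injective hy (h0.trans (map_zero _).symm)
    exact (LinearEquiv.map_eq_zero_iff _).1 this

theorem continuousOn_det_chartForm (h : SmoothMetric I N) (c : N) :
    ContinuousOn (fun y => (LinearMap.BilinForm.toMatrix (Module.finBasis ℝ E) (chartForm h c y)).det)
      (extChartAt I c).target := by
  simp only [Matrix.det_apply, LinearMap.BilinForm.toMatrix_apply]
  refine continuousOn_finsetSum _ fun σ _ => ContinuousOn.const_smul ?_ _
  exact continuousOn_finsetProd _ fun i _ => continuousOn_chartForm h c _ _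

/-- Near the centre of a chart, the determinant of the metric is bounded above and below. -/
theorem exists_ball_det_chartForm (h : SmoothMetric I N) (c : N) :
    ∃ ε > 0, ∃ δ > 0, ∃ B, Metric.ball (extChartAt I c c) ε ⊆ (extChartAt I c).target ∧
      ∀ y ∈ Metric.ball (extChartAt I c c) ε,
        δ ≤ (LinearMap.BilinForm.toMatrix (Module.finBasis ℝ E) (chartForm h c y)).det ∧
        (LinearMap.BilinForm.toMatrix (Module.finBasis ℝ E) (chartForm h c y)).det ≤ B := by
  have hc := mem_extChartAt_target (I := I) c
  have hU := (isOpen_extChartAt_target (I := I) c).mem_nhds hc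
  have hcont := (continuousOn_det_chartForm h c).continuousAt hU
  have hpos := det_chartForm_pos h hc
  obtain ⟨ε, hε, hball⟩ := Metric.mem_nhds_iff.1 (inter_mem hU
    (hcont (Ioo_mem_nhds (half_lt_self hpos) (lt_add_one _))))
  exact ⟨ε, hε, _, half_pos hpos, _, fun y hy => (hball hy).1,
    fun y hy => ⟨(hball hy).2.1.le, (hball hy).2.2.le⟩⟩

end ChartForm

/-! ### Charts of the cylinder -/

section CylChart

set_option linter.unusedSectionVars false

variable {E : Type*} [NormedAddCommGroup E] [NormedSpace ℝ E]
  {H : Type*} [TopologicalSpace H] {I : ModelWithCorners ℝ E H} [I.Boundaryless]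
  {N : Type*} [TopologicalSpace N] [ChartedSpace H N] [IsManifold I ∞ N]

variable (I) in
/-- The inverse of the chart of `ℝ × N` given by the chart of `N` centred at `c`. -/
noncomputable def cylChartSymm (c : N) : ℝ × E → ℝ × N := Prod.map id (extChartAt I c).symm

theorem extChartAt_cyl_symm (a : ℝ) (c : N) :
    ((extChartAt (𝓘(ℝ, ℝ).prod I) ((a, c) : ℝ × N)).symm : ℝ × E → ℝ × N) =
      cylChartSymm I c := by
  rw [extChartAt_prod]
  rfl

theorem extChartAt_cyl_target (a : ℝ) (c : N) :
    (extChartAt (𝓘(ℝ, ℝ).prod I) ((a, c) : ℝ × N)).target = univ ×ˢ (extChartAt I c).target := by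
  rw [extChartAt_prod, PartialEquiv.prod_target, extChartAt_model_space_eq_id]
  rfl

theorem hasMFDerivAt_cylChartSymm {c : N} {y : ℝ × E} (hy : y.2 ∈ (extChartAt I c).target) :
    HasMFDerivAt 𝓘(ℝ, ℝ × E) (𝓘(ℝ, ℝ).prod I) (cylChartSymm I c) y
      ((ContinuousLinearMap.id ℝ ℝ).prodMap (mfderiv 𝓘(ℝ, E) I (extChartAt I c).symm y.2) :
        (ℝ × E) →L[ℝ] (ℝ × E)) := by
  have h1 := (hasMFDerivAt_id (I := 𝓘(ℝ, ℝ)) y.1).prodMap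
    (mdifferentiableAt_extChartAt_symm hy).hasMFDerivAt
  rw [mfderiv_id] at h1
  rw [modelWithCornersSelf_prod, ← chartedSpaceSelf_prod]
  exact h1

theorem warped_cylChartSymm (f : ℝ → ℝ) (h : SmoothMetric I N) {c : N} {y : ℝ × E}
    (hy : y.2 ∈ (extChartAt I c).target) (v w : ℝ × E) :
    warped f h (cylChartSymm I c y)
        (mfderiv 𝓘(ℝ, ℝ × E) (𝓘(ℝ, ℝ).prod I) (cylChartSymm I c) y v)
        (mfderiv 𝓘(ℝ, ℝ × E) (𝓘(ℝ, ℝ).prod I) (cylChartSymm I c) y w) =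
      warpForm (f y.1) (chartForm h c y.2) v w := by
  rw [(hasMFDerivAt_cylChartSymm hy).mfderiv]
  exact warped_apply f h (cylChartSymm I c y) _ _

end CylChart

/-! ### Finite volume of the cusp -/

section Volume

set_option linter.unusedSectionVars false

variable {E : Type*} [NormedAddCommGroup E] [NormedSpace ℝ E] [FiniteDimensional ℝ E]
  {H : Type*} [TopologicalSpace H] {I : ModelWithCorners ℝ E H} [I.Boundaryless]
  {N : Type*} [TopologicalSpace N] [ChartedSpace H N] [IsManifold I ∞ N]

theorem exists_finite_chart_cover [CompactSpace N] (A : N → Set E)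
    (hA : ∀ c, A c ∈ 𝓝 (extChartAt I c c)) :
    ∃ t : Finset N, ∀ x : N, ∃ c ∈ t, x ∈ (extChartAt I c).source ∧ extChartAt I c x ∈ A c := by
  obtain ⟨t, ht⟩ := CompactSpace.elim_nhds_subcover
    (fun c => (extChartAt I c).source ∩ extChartAt I c ⁻¹' A c) fun c =>
      inter_mem (extChartAt_source_mem_nhds c) ((continuousAt_extChartAt c).preimage_mem_nhds (hA c))
  refine ⟨t, fun x => ?_⟩
  have : x ∈ ⋃ c ∈ t, (extChartAt I c).source ∩ extChartAt I c ⁻¹' A c := ht ▸ mem_univ x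
  simpa [and_left_comm] using this

/-- By uniqueness of Haar measure μ is a multiple of a product measure, and Fubini reduces the claim
to the integrability of e^{-z}. An arbitrary μ is allowed since the basis that normalises the volume
need not be adapted to the product. -/
theorem lintegral_cusp_ball_lt_top [MeasurableSpace E] [BorelSpace E] (μ : Measure (ℝ × E))
    [μ.IsAddHaarMeasure] (x : E) (ε C : ℝ) :
    ∫⁻ y in Ici (0 : ℝ) ×ˢ Metric.ball x ε, ENNReal.ofReal (C * Real.exp (-y.1)) ∂μ < ⊤ := by
  set ν : Measure E := Measure.addHaar
  rw [Measure.isAddLeftInvariant_eq_smul μ ((volume : Measure ℝ).prod ν), Measure.restrict_smul,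
    lintegral_smul_measure, ← Measure.prod_restrict,
    lintegral_prod _ (by fun_prop)]
  refine ENNReal.mul_lt_top ENNReal.coe_lt_top ?_
  simp only [lintegral_const, Measure.restrict_apply MeasurableSet.univ, univ_inter]
  rw [lintegral_mul_const' _ _ measure_ball_lt_top.ne]
  refine ENNReal.mul_lt_top ?_ measure_ball_lt_top
  have : IntegrableOn (fun z : ℝ => C * Real.exp (-z)) (Ici 0) :=
    (integrableOn_Ici_iff_integrableOn_Ioi (by simp)).2 ((integrableOn_exp_neg_Ioi 0).const_mul C)
  exact this.lintegral_lt_top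

theorem riemannianVolume_cusp_lt_top [CompactSpace N] [Nonempty N] [MeasurableSpace E] [BorelSpace E]
    (hE : 0 < Module.finrank ℝ E) (h : SmoothMetric I N) :
    riemannianVolume (𝓘(ℝ, ℝ).prod I) (warped (fun z => Real.exp (-z)) h) (halfCyl N 0) < ⊤ := by
  choose ε hε δ hδ B hball hdet using exists_ball_det_chartForm h
  obtain ⟨t, ht⟩ := exists_finite_chart_cover (I := I)
    (fun c => Metric.ball (extChartAt I c c) (ε c)) fun c => Metric.ball_mem_nhds _ (hε c)
  obtain ⟨c₀⟩ := ‹Nonempty N›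
  obtain ⟨a, ha⟩ := exists_det_toMatrix_eq (Module.finBasis ℝ (ℝ × E))
    (prodBasis (Module.finBasis ℝ E))
  -- The volume is an infimum over countable covers, so the finite family of chart cylinders is
  -- padded with empty sets.
  set l := t.toList
  let c : ℕ → N := fun i => l.getD i c₀
  let A : ℕ → Set (ℝ × E) := fun i => if i < l.length then
    Ici (0 : ℝ) ×ˢ Metric.ball (extChartAt I (c i) (c i)) (ε (c i)) else ∅
  have hterm : ∀ i, ∫⁻ y in A i, ENNReal.ofReal (√ (coordMetric (𝓘(ℝ, ℝ).prod I)
      (warped (fun z => Real.exp (-z)) h) ((0 : ℝ), c i) y).det)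
      ∂(Module.finBasis ℝ (ℝ × E)).addHaar < ⊤ := by
    intro i
    by_cases hi : i < l.length
    swap
    · simp [A, hi]
    simp only [A, hi, if_true]
    refine lt_of_le_of_lt (setLIntegral_mono' (measurableSet_Ici.prod measurableSet_ball)
      fun y hy => ?_) (lintegral_cusp_ball_lt_top _ _ _ (√ (a ^ 2 * B (c i))))
    have hy2 := hball _ hy.2
    have hmat : coordMetric (𝓘(ℝ, ℝ).prod I) (warped (fun z => Real.exp (-z)) h)
        ((0 : ℝ), c i) y = LinearMap.BilinForm.toMatrix (Module.finBasis ℝ (ℝ × E))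
          (warpForm (Real.exp (-y.1)) (chartForm h (c i) y.2)) := by
      ext j k
      rw [LinearMap.BilinForm.toMatrix_apply, coordMetric, Matrix.of_apply, extChartAt_cyl_symm]
      exact warped_cylChartSymm _ h hy2 _ _
    rw [hmat, ha, det_toMatrix_warpForm]
    refine ENNReal.ofReal_le_ofReal (Real.sqrt_le_iff.2 ⟨by positivity, ?_⟩)
    have hD := hdet _ _ hy.2
    have hB0 : 0 ≤ B (c i) := (hδ _).le.trans (hD.1.trans hD.2)
    rw [mul_pow, Real.sq_sqrt (by positivity)]
    have hy1 : (0 : ℝ) ≤ y.1 := hy.1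
    -- The determinant carries e^{-2mz} with m = dim N ≥ 1. At heights z ≥ 0 this is at most
    -- e^{-2z}, which leaves e^{-z} after the square root.
    have h1 : Real.exp (-y.1) ^ (2 * Fintype.card (CoordIdx E)) ≤ Real.exp (-y.1) ^ 2 := by
      refine pow_le_pow_of_le_one (Real.exp_pos _).le (Real.exp_le_one_iff.2 (by linarith)) ?_
      rw [Fintype.card_fin]; omega
    have h2 := mul_le_mul h1 hD.2 ((hδ _).le.trans hD.1) (by positivity)
    calc _ ≤ a ^ 2 * (Real.exp (-y.1) ^ 2 * B (c i)) := by gcongr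
      _ = _ := by ring
  refine lt_of_le_of_lt (iInf₂_le_of_le (fun i => ((0 : ℝ), c i)) A
    (iInf₂_le_of_le ?_ ?_ le_rfl)) ?_
  · intro i
    by_cases hi : i < l.length
    · simp only [A, hi, if_true, extChartAt_cyl_target]
      exact ⟨measurableSet_Ici.prod measurableSet_ball, prod_mono (subset_univ _) (hball _)⟩
    · simp [A, hi]
  · intro p hp
    obtain ⟨d, hd, hs, hdb⟩ := ht p.2
    obtain ⟨i, hi, rfl⟩ := List.mem_iff_getElem.1 (Finset.mem_toList.2 hd)
    have hci : c i = l[i] := by simp only [c, l, List.getD_eq_getElem _ _ hi]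
    refine mem_iUnion.2 ⟨i, (p.1, extChartAt I (c i) p.2), ?_, ?_⟩
    · simp only [A, l, hi, if_true]
      refine ⟨hp.1, ?_⟩
      rw [hci]
      exact hdb
    · rw [extChartAt_cyl_symm, hci]
      exact Prod.ext rfl ((extChartAt I l[i]).left_inv hs)
  · rw [tsum_eq_sum (s := Finset.range l.length)]
    · exact ENNReal.sum_lt_top.2 fun i _ => hterm i
    · intro i hi
      have : ¬ i < l.length := by simpa using hi
      simp [A, this]

end Volume

/-! ### Pointwise and one-dimensional estimates for the length-area argument -/

section Pointwise

variable {E : Type*} [NormedAddCommGroup E] [NormedSpace ℝ E] [FiniteDimensional ℝ E]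

/-- The radial derivative of a map that is conformal from `b`- to `a`-warped forms is controlled by
its Jacobian. -/
theorem abs_div_pow_mul_le_of_conformal {D : (ℝ × E) →L[ℝ] (ℝ × E)} {a b lam δ B : ℝ}
    {H H' : LinearMap.BilinForm ℝ E} (ha : 0 < a) (hb : 0 < b) (hlam : 0 < lam)
    (hH : ∀ v, 0 ≤ H v v)
    (hD : ∀ v w, warpForm a H (D v) (D w) = lam * warpForm b H' v w) (hδ : 0 < δ)
    (hdet' : δ ≤ (LinearMap.BilinForm.toMatrix (Module.finBasis ℝ E) H').det)
    (hdet : (LinearMap.BilinForm.toMatrix (Module.finBasis ℝ E) H).det ≤ B) :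
    (|(D (1, 0)).1| / a) ^ (Module.finrank ℝ E + 1) * b ^ Module.finrank ℝ E ≤
      √ (B / δ) * (|D.det| * (1 / a)) := by
  set m := Module.finrank ℝ E with hm
  set s := |(D (1, 0)).1| with hs
  -- The radial vector (1, 0) has square length 1 in the source, hence lam in the target, and its
  -- radial part is no longer.
  have h1 : s ^ 2 ≤ lam := by
    have := hD (1, 0) (1, 0)
    simp only [warpForm_apply, map_zero, mul_zero, add_zero, mul_one] at this
    rw [hs, sq_abs, sq]
    nlinarith [mul_nonneg (sq_nonneg a) (hH (D (1, 0)).2)]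
  -- Conformality compared on determinants; m + 1 is the dimension of ℝ × E.
  have h2 : D.det ^ 2 * (a ^ (2 * m) *
      (LinearMap.BilinForm.toMatrix (Module.finBasis ℝ E) H).det) = lam ^ (m + 1) * (b ^ (2 * m) *
      (LinearMap.BilinForm.toMatrix (Module.finBasis ℝ E) H').det) := by
    have e1 : LinearMap.BilinForm.comp (warpForm a H) (D : (ℝ × E) →ₗ[ℝ] ℝ × E)
        (D : (ℝ × E) →ₗ[ℝ] ℝ × E) = lam • warpForm b H' := by
      ext v w <;> simp [hD]
    have e2 := det_toMatrix_comp (prodBasis (Module.finBasis ℝ E)) (warpForm a H)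
      (D : (ℝ × E) →ₗ[ℝ] ℝ × E)
    rw [e1, map_smul, Matrix.det_smul, det_toMatrix_warpForm, det_toMatrix_warpForm] at e2
    simp only [Fintype.card_sum, Fintype.card_unit, Fintype.card_fin, ← hm] at e2
    rw [add_comm m 1]
    exact e2.symm
  have h3 : (s ^ (m + 1) * b ^ m) ^ 2 * δ ≤ B * (|D.det| * a ^ m) ^ 2 := by
    calc (s ^ (m + 1) * b ^ m) ^ 2 * δ = (s ^ 2) ^ (m + 1) * (b ^ (2 * m) * δ) := by ring
      _ ≤ lam ^ (m + 1) * (b ^ (2 * m) *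
          (LinearMap.BilinForm.toMatrix (Module.finBasis ℝ E) H').det) := by gcongr
      _ = D.det ^ 2 * (a ^ (2 * m) *
          (LinearMap.BilinForm.toMatrix (Module.finBasis ℝ E) H).det) := h2.symm
      _ ≤ D.det ^ 2 * (a ^ (2 * m) * B) := by gcongr
      _ = B * (|D.det| * a ^ m) ^ 2 := by rw [mul_pow, sq_abs]; ring
  have h4 : s ^ (m + 1) * b ^ m ≤ √ (B / δ) * (|D.det| * a ^ m) := by
    have h5 : 0 ≤ |D.det| * a ^ m := by positivity
    rw [← Real.sqrt_sq h5, ← Real.sqrt_mul' _ (sq_nonneg _)]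
    refine Real.le_sqrt_of_sq_le ?_
    rw [div_mul_eq_mul_div, le_div_iff₀ hδ]
    exact h3
  rw [div_pow, div_mul_eq_mul_div, div_le_iff₀ (by positivity)]
  refine h4.trans (le_of_eq ?_)
  field_simp
  ring

/-- If |x| exceeds M/b, then (|x| b / M)^m ≥ 1 can be inserted as a factor. The free parameter M
makes the coefficient of the power term small. -/
theorem abs_le_div_add_pow_mul {x b M : ℝ} (m : ℕ) (hb : 0 < b) (hM : 0 < M) :
    |x| ≤ M / b + |x| ^ (m + 1) * b ^ m / M ^ m := by
  rcases le_total (|x|) (M / b) with h | h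
  · exact h.trans (le_add_of_nonneg_right (by positivity))
  · have h1 : 1 ≤ |x| * b / M := by
      rw [le_div_iff₀ hM, one_mul]
      exact (div_le_iff₀ hb).1 h
    have h2 := one_le_pow₀ h1 (n := m)
    calc |x| = |x| * 1 := (mul_one _).symm
      _ ≤ |x| * (|x| * b / M) ^ m := by gcongr
      _ = |x| ^ (m + 1) * b ^ m / M ^ m := by rw [div_pow, mul_pow]; ring
      _ ≤ _ := le_add_of_nonneg_left (by positivity)

/-- The variation needed to climb from `A` to `B` is spent below `B`. -/
theorem ofReal_sub_le_lintegral_abs_deriv {η : ℝ → ℝ} {A B r₁ : ℝ}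
    (hc : ContinuousOn η (Ici 0)) (hd : ∀ r, 0 < r → DifferentiableAt ℝ η r) (h0 : η 0 ≤ A)
    (hr₁ : 0 ≤ r₁) (hB : B ≤ η r₁) :
    ENNReal.ofReal (B - A) ≤ ∫⁻ r in Ioi 0 ∩ {r | η r < B}, ENNReal.ofReal |deriv η r| := by
  rcases le_or_gt B A with hBA | hAB
  · rw [ENNReal.ofReal_of_nonpos (sub_nonpos.2 hBA)]
    exact zero_le
  -- The infimum ρ of this set is the first time at which η reaches B, so η stays below B on (0, ρ).
  set s := Icc 0 r₁ ∩ η ⁻¹' Ici B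
  have hsne : s.Nonempty := ⟨r₁, ⟨hr₁, le_rfl⟩, hB⟩
  have hscl : IsClosed s :=
    (hc.mono Icc_subset_Ici_self).preimage_isClosed_of_isClosed isClosed_Icc isClosed_Ici
  have hsbd : BddBelow s := ⟨0, fun r hr => hr.1.1⟩
  have hmem := hscl.csInf_mem hsne hsbd
  set ρ := sInf s
  have hlt : ∀ r ∈ Ioo 0 ρ, η r < B := fun r hr => by
    by_contra! h
    exact absurd (csInf_le hsbd ⟨⟨hr.1.le, hr.2.le.trans hmem.1.2⟩, h⟩) (not_le.2 hr.2)
  have hsub : Ioo 0 ρ ⊆ Ioi 0 ∩ {r | η r < B} := fun r hr => ⟨hr.1, hlt r hr⟩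
  refine le_trans ?_ (lintegral_mono_set hsub)
  -- Infinite variation leaves nothing to prove; otherwise η' is integrable and the fundamental
  -- theorem of calculus applies.
  by_cases hfin : ∫⁻ r in Ioo 0 ρ, ENNReal.ofReal |deriv η r| = ⊤
  · rw [hfin]; exact le_top
  have hint : IntegrableOn (deriv η) (Ioo 0 ρ) := by
    refine ⟨(measurable_deriv η).aestronglyMeasurable, ?_⟩
    rw [hasFiniteIntegral_iff_norm]
    exact lt_top_iff_ne_top.2 hfin
  have hii : IntervalIntegrable (deriv η) volume 0 ρ :=
    (intervalIntegrable_iff_integrableOn_Ioo_of_le hmem.1.1).2 hint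
  have hftc := intervalIntegral.integral_eq_sub_of_hasDerivAt_of_le hmem.1.1
    (hc.mono Icc_subset_Ici_self) (fun r hr => (hd r hr.1).hasDerivAt) hii
  have hle : B - A ≤ ∫ r in Ioo 0 ρ, |deriv η r| := by
    have h1 : B ≤ η ρ := hmem.2
    calc B - A ≤ ∫ r in (0 : ℝ)..ρ, deriv η r := by rw [hftc]; linarith
      _ ≤ |∫ r in (0 : ℝ)..ρ, deriv η r| := le_abs_self _
      _ ≤ ∫ r in (0 : ℝ)..ρ, |deriv η r| :=
        intervalIntegral.abs_integral_le_integral_abs hmem.1.1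
      _ = _ := by rw [intervalIntegral.integral_of_le hmem.1.1, integral_Ioc_eq_integral_Ioo]
  rw [← ofReal_integral_eq_lintegral_ofReal hint.abs (Eventually.of_forall fun r => abs_nonneg _)]
  exact ENNReal.ofReal_le_ofReal hle

end Pointwise

/-! ### Conformal maps in cylinder charts -/

section Transition

set_option linter.unusedSectionVars false

variable {E : Type*} [NormedAddCommGroup E] [NormedSpace ℝ E]
  {H : Type*} [TopologicalSpace H] {I : ModelWithCorners ℝ E H} [I.Boundaryless]
  {N : Type*} [TopologicalSpace N] [ChartedSpace H N] [IsManifold I ∞ N]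

variable (I) in
/-- A map of `ℝ × N` in the charts of `N` centred at `c'` (source) and `c` (target). -/
noncomputable def inCylCharts (Ψ : ℝ × N → ℝ × N) (c' c : N) (y : ℝ × E) : ℝ × E :=
  ((Ψ (cylChartSymm I c' y)).1, extChartAt I c (Ψ (cylChartSymm I c' y)).2)

theorem warped_congr (f : ℝ → ℝ) (h : SmoothMetric I N) {p q : ℝ × N} (hpq : p = q)
    (v w : ℝ × E) :
    warped f h p (show TangentSpace (𝓘(ℝ, ℝ).prod I) p from v) (show TangentSpace _ p from w) =
      warped f h q (show TangentSpace (𝓘(ℝ, ℝ).prod I) q from v)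
        (show TangentSpace _ q from w) := by
  subst hpq; rfl

theorem halfCyl_mem_nhds {q : ℝ × N} {a : ℝ} (hq : a < q.1) : halfCyl N a ∈ 𝓝 q :=
  prod_mem_nhds (Ici_mem_nhds hq) univ_mem

theorem mdifferentiableAt_cylChart {c : N} {p : ℝ × N} (hp : p.2 ∈ (extChartAt I c).source) :
    MDifferentiableAt (𝓘(ℝ, ℝ).prod I) 𝓘(ℝ, ℝ × E)
      (Prod.map (id : ℝ → ℝ) (extChartAt I c)) p := by
  rw [extChartAt_source] at hp
  have h1 := (mdifferentiableAt_id (I := 𝓘(ℝ, ℝ)) (x := p.1)).prodMap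
    (mdifferentiableAt_extChartAt (I := I) hp)
  rw [modelWithCornersSelf_prod, ← chartedSpaceSelf_prod]
  exact h1

/-- The inverse `Ψ` of a conformal diffeomorphism is conformal, in the interior. -/
theorem warped_mfderiv_inverse {f g : ℝ → ℝ} {h h' : SmoothMetric I N} {a b : ℝ}
    {Φ Ψ : ℝ × N → ℝ × N} (hΦ : ContMDiffOn (𝓘(ℝ, ℝ).prod I) (𝓘(ℝ, ℝ).prod I) ∞ Φ (halfCyl N a))
    (hΨ : ContMDiffOn (𝓘(ℝ, ℝ).prod I) (𝓘(ℝ, ℝ).prod I) ∞ Ψ (halfCyl N b))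
    (hmaps : MapsTo Ψ (halfCyl N b) (halfCyl N a)) (hinv : ∀ q ∈ halfCyl N b, Φ (Ψ q) = q)
    {u : ℝ × N → ℝ} (hu : ∀ p ∈ halfCyl N a, 0 < u p)
    (hconf : ∀ p ∈ halfCyl N a, ∀ v w : TangentSpace (𝓘(ℝ, ℝ).prod I) p,
      warped g h' (Φ p) (mfderivWithin (𝓘(ℝ, ℝ).prod I) (𝓘(ℝ, ℝ).prod I) Φ (halfCyl N a) p v)
        (mfderivWithin (𝓘(ℝ, ℝ).prod I) (𝓘(ℝ, ℝ).prod I) Φ (halfCyl N a) p w) =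
      u p * warped f h p v w)
    {q : ℝ × N} (hq : b < q.1) (v w : TangentSpace (𝓘(ℝ, ℝ).prod I) q) :
    warped f h (Ψ q) (mfderiv (𝓘(ℝ, ℝ).prod I) (𝓘(ℝ, ℝ).prod I) Ψ q v)
      (mfderiv (𝓘(ℝ, ℝ).prod I) (𝓘(ℝ, ℝ).prod I) Ψ q w) = (u (Ψ q))⁻¹ * warped g h' q v w := by
  have hT : halfCyl N b ∈ 𝓝 q := halfCyl_mem_nhds hq
  have hqT : q ∈ halfCyl N b := mem_of_mem_nhds hT
  have hS := hmaps hqT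
  have h1 : HasMFDerivAt (𝓘(ℝ, ℝ).prod I) (𝓘(ℝ, ℝ).prod I) Ψ q
      (mfderiv (𝓘(ℝ, ℝ).prod I) (𝓘(ℝ, ℝ).prod I) Ψ q) :=
    ((hΨ.contMDiffAt hT).mdifferentiableAt (by simp)).hasMFDerivAt
  -- A priori Ψ q may lie on the boundary, so the derivative of Φ is taken within the half-cylinder.
  -- The composite still has a full derivative, q being an interior point.
  have h2 : HasMFDerivWithinAt (𝓘(ℝ, ℝ).prod I) (𝓘(ℝ, ℝ).prod I) Φ (halfCyl N a) (Ψ q)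
      (mfderivWithin (𝓘(ℝ, ℝ).prod I) (𝓘(ℝ, ℝ).prod I) Φ (halfCyl N a) (Ψ q)) :=
    ((hΦ _ hS).mdifferentiableWithinAt (by simp)).hasMFDerivWithinAt
  have h3 := (h2.comp q h1.hasMFDerivWithinAt hmaps).hasMFDerivAt hT
  have h4 : Φ ∘ Ψ =ᶠ[𝓝 q] id := by filter_upwards [hT] with x hx using hinv x hx
  have h5 := hasMFDerivAt_unique (h3.congr_of_eventuallyEq h4.symm) (hasMFDerivAt_id q)
  have h6 : ∀ v : ℝ × E, mfderivWithin (𝓘(ℝ, ℝ).prod I) (𝓘(ℝ, ℝ).prod I) Φ (halfCyl N a) (Ψ q)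
      (mfderiv (𝓘(ℝ, ℝ).prod I) (𝓘(ℝ, ℝ).prod I) Ψ q v) = v := fun v =>
    congrArg (fun L : (ℝ × E) →L[ℝ] (ℝ × E) => L v) h5
  have h7 := hconf _ hS (mfderiv (𝓘(ℝ, ℝ).prod I) (𝓘(ℝ, ℝ).prod I) Ψ q v)
    (mfderiv (𝓘(ℝ, ℝ).prod I) (𝓘(ℝ, ℝ).prod I) Ψ q w)
  rw [eq_inv_mul_iff_mul_eq₀ (hu _ hS).ne', ← h7]
  refine Eq.trans ?_ (warped_congr g h' (hinv q hqT) v w)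
  rw [h6 v, h6 w]

/-- Near y the map factors as Ψ∘(source chart)⁻¹ = (target chart)⁻¹∘F, with F its coordinate
expression. Differentiating this identity carries conformality of Ψ over to the derivative of F. -/
theorem exists_hasFDerivAt_inCylCharts {f g : ℝ → ℝ} {h h' : SmoothMetric I N} {b : ℝ}
    {Ψ : ℝ × N → ℝ × N}
    (hΨ : ContMDiffOn (𝓘(ℝ, ℝ).prod I) (𝓘(ℝ, ℝ).prod I) ∞ Ψ (halfCyl N b)) {lam : ℝ}
    {c' c : N} {y : ℝ × E} (hy1 : b < y.1) (hy2 : y.2 ∈ (extChartAt I c').target)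
    (hyc : (Ψ (cylChartSymm I c' y)).2 ∈ (extChartAt I c).source)
    (hconf : ∀ v w : TangentSpace (𝓘(ℝ, ℝ).prod I) (cylChartSymm I c' y),
      warped f h (Ψ (cylChartSymm I c' y))
        (mfderiv (𝓘(ℝ, ℝ).prod I) (𝓘(ℝ, ℝ).prod I) Ψ (cylChartSymm I c' y) v)
        (mfderiv (𝓘(ℝ, ℝ).prod I) (𝓘(ℝ, ℝ).prod I) Ψ (cylChartSymm I c' y) w) =
      lam * warped g h' (cylChartSymm I c' y) v w) :
    ∃ D : (ℝ × E) →L[ℝ] (ℝ × E), HasFDerivAt (inCylCharts I Ψ c' c) D y ∧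
      ∀ v w, warpForm (f (inCylCharts I Ψ c' c y).1) (chartForm h c (inCylCharts I Ψ c' c y).2)
        (D v) (D w) = lam * warpForm (g y.1) (chartForm h' c' y.2) v w := by
  have hT : halfCyl N b ∈ 𝓝 (cylChartSymm I c' y) := halfCyl_mem_nhds hy1
  have h1 : HasMFDerivAt 𝓘(ℝ, ℝ × E) (𝓘(ℝ, ℝ).prod I) (cylChartSymm I c') y
    (mfderiv 𝓘(ℝ, ℝ × E) (𝓘(ℝ, ℝ).prod I) (cylChartSymm I c') y) :=
    (hasMFDerivAt_cylChartSymm hy2).mdifferentiableAt.hasMFDerivAt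
  have h2 : HasMFDerivAt (𝓘(ℝ, ℝ).prod I) (𝓘(ℝ, ℝ).prod I) Ψ (cylChartSymm I c' y)
      (mfderiv (𝓘(ℝ, ℝ).prod I) (𝓘(ℝ, ℝ).prod I) Ψ (cylChartSymm I c' y)) :=
    ((hΨ.contMDiffAt hT).mdifferentiableAt (by simp)).hasMFDerivAt
  have h12 := h2.comp y h1
  have h3 := (mdifferentiableAt_cylChart hyc).hasMFDerivAt.comp y h12
  set D : (ℝ × E) →L[ℝ] (ℝ × E) := mfderiv 𝓘(ℝ, ℝ × E) 𝓘(ℝ, ℝ × E) (inCylCharts I Ψ c' c) y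
  have hD' : HasMFDerivAt 𝓘(ℝ, ℝ × E) 𝓘(ℝ, ℝ × E) (inCylCharts I Ψ c' c) y D := by
    have : MDifferentiableAt 𝓘(ℝ, ℝ × E) 𝓘(ℝ, ℝ × E) (inCylCharts I Ψ c' c) y :=
      h3.mdifferentiableAt
    exact this.hasMFDerivAt
  have hFy : (inCylCharts I Ψ c' c y).2 ∈ (extChartAt I c).target :=
    (extChartAt I c).map_source hyc
  have h4 : HasMFDerivAt 𝓘(ℝ, ℝ × E) (𝓘(ℝ, ℝ).prod I) (cylChartSymm I c)
      (inCylCharts I Ψ c' c y) (mfderiv 𝓘(ℝ, ℝ × E) (𝓘(ℝ, ℝ).prod I) (cylChartSymm I c)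
        (inCylCharts I Ψ c' c y)) :=
    (hasMFDerivAt_cylChartSymm hFy).mdifferentiableAt.hasMFDerivAt
  have h5 := h4.comp y hD'
  have hev : Ψ ∘ cylChartSymm I c' =ᶠ[𝓝 y] cylChartSymm I c ∘ inCylCharts I Ψ c' c := by
    have hc : ContinuousAt (fun x => (Ψ (cylChartSymm I c' x)).2) y := h12.continuousAt.snd
    filter_upwards [hc ((isOpen_extChartAt_source c).mem_nhds hyc)] with x hx
    exact Prod.ext rfl ((extChartAt I c).left_inv hx).symm
  have h6 := hasMFDerivAt_unique (h5.congr_of_eventuallyEq hev) h12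
  have h7 : ∀ v : ℝ × E, mfderiv 𝓘(ℝ, ℝ × E) (𝓘(ℝ, ℝ).prod I) (cylChartSymm I c)
        (inCylCharts I Ψ c' c y) (D v) =
      mfderiv (𝓘(ℝ, ℝ).prod I) (𝓘(ℝ, ℝ).prod I) Ψ (cylChartSymm I c' y)
        (mfderiv 𝓘(ℝ, ℝ × E) (𝓘(ℝ, ℝ).prod I) (cylChartSymm I c') y v) := fun v =>
    congrArg (fun L : (ℝ × E) →L[ℝ] (ℝ × E) => L v) h6
  refine ⟨D, hasMFDerivAt_iff_hasFDerivAt.1 hD', fun v w => ?_⟩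
  rw [← warped_cylChartSymm f h hFy, ← warped_cylChartSymm g h' hy2, ← hconf]
  refine Eq.trans ?_ (warped_congr f h hev.self_of_nhds.symm _ _)
  rw [h7 v, h7 w]
  rfl

end Transition

/-! ### The length-area inequality -/

section Modulus

variable {E : Type*} [NormedAddCommGroup E] [NormedSpace ℝ E] [FiniteDimensional ℝ E]
  [MeasurableSpace E] [BorelSpace E]

/-- As F is injective, the left side is the integral of 1/f over the image F(P), which is contained
in [0, Z] × A; Fubini finishes. -/
theorem lintegral_abs_det_mul_le {f : ℝ → ℝ} (hf : ContinuousOn f (Ici 0))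
    (hpos : ∀ z ∈ Ici (0 : ℝ), 0 < f z) {F : ℝ × E → ℝ × E} {P : Set (ℝ × E)} {A : Set E} {Z : ℝ}
    (hZ : 0 ≤ Z) (ν : Measure E) [ν.IsAddHaarMeasure] (hP : IsOpen P)
    (hd : ∀ y ∈ P, DifferentiableAt ℝ F y) (hinj : InjOn F P)
    (hmaps : MapsTo F P (Icc 0 Z ×ˢ A)) :
    ∫⁻ y in P, ENNReal.ofReal |(fderiv ℝ F y).det| * ENNReal.ofReal (1 / f (F y).1)
      ∂(volume : Measure ℝ).prod ν ≤ ENNReal.ofReal (recipPrimitive f Z) * ν A := by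
  rw [← lintegral_image_eq_lintegral_abs_det_fderiv_mul ((volume : Measure ℝ).prod ν)
    hP.measurableSet (fun y hy => (hd y hy).hasFDerivAt.hasFDerivWithinAt) hinj
    (fun y => ENNReal.ofReal (1 / f y.1))]
  refine (lintegral_mono_set hmaps.image_subset).trans ?_
  rw [← Measure.prod_restrict, ← lintegral_Icc_one_div hf hpos hZ]
  have hm : AEMeasurable (fun s => ENNReal.ofReal (1 / f s)) (volume.restrict (Icc 0 Z)) := by
    refine ENNReal.measurable_ofReal.comp_aemeasurable
      (ContinuousOn.aemeasurable ?_ measurableSet_Icc)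
    exact continuousOn_const.div (hf.mono Icc_subset_Ici_self) fun s hs => (hpos s hs.1).ne'
  have := lintegral_prod_mul (μ := volume.restrict (Icc 0 Z)) (ν := ν.restrict A) hm
    (g := fun _ => 1) aemeasurable_const
  simp only [mul_one, lintegral_const, Measure.restrict_apply MeasurableSet.univ, univ_inter,
    one_mul] at this
  exact this.le

theorem aemeasurable_indicator_abs_det_mul {f : ℝ → ℝ} (hf : ContinuousOn f (Ici 0))
    (hpos : ∀ z ∈ Ici (0 : ℝ), 0 < f z) {F : ℝ × E → ℝ × E} {P : Set (ℝ × E)}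
    (μ : Measure (ℝ × E)) (hP : IsOpen P) (hd : ∀ y ∈ P, DifferentiableAt ℝ F y)
    (h0 : ∀ y ∈ P, 0 ≤ (F y).1) :
    AEMeasurable (P.indicator fun y =>
      ENNReal.ofReal |(fderiv ℝ F y).det| * ENNReal.ofReal (1 / f (F y).1)) μ := by
  rw [aemeasurable_indicator_iff hP.measurableSet]
  have hF : ContinuousOn F P := fun y hy => (hd y hy).continuousAt.continuousWithinAt
  have h1 : Measurable fun y => ENNReal.ofReal |(fderiv ℝ F y).det| :=
    ENNReal.measurable_ofReal.comp ((continuous_abs.comp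
      ContinuousLinearMap.continuous_det).measurable.comp (measurable_fderiv ℝ F))
  have h2 : AEMeasurable (fun y => ENNReal.ofReal (1 / f (F y).1)) (μ.restrict P) := by
    refine ENNReal.measurable_ofReal.comp_aemeasurable
      (ContinuousOn.aemeasurable ?_ hP.measurableSet)
    exact continuousOn_const.div (hf.comp (continuous_fst.comp_continuousOn hF) h0)
      fun y hy => (hpos _ (h0 y hy)).ne'
  exact h1.aemeasurable.mul h2

/-- A half-infinite cylinder cannot be mapped quasiconformally onto a cylinder of finite modulus:
`F c` are local coordinate expressions of such a map, with radial coordinate `ζ`. -/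
theorem lintegral_one_div_lt_top_of_jacobian_bound {f g : ℝ → ℝ} (hf : ContinuousOn f (Ici 0))
    (hpos : ∀ z ∈ Ici (0 : ℝ), 0 < f z) (hg : Measurable g) (hgpos : ∀ r, 0 < r → 0 < g r)
    (hgint : ∫⁻ r in Ioi 0, ENNReal.ofReal (1 / g r) < ⊤) (ν : Measure E) [ν.IsAddHaarMeasure]
    {U : Set E} (hU : MeasurableSet U) (hU0 : ν U ≠ 0) (hU1 : ν U ≠ ⊤)
    {ι : Type*} (t : Finset ι) (F : ι → ℝ × E → ℝ × E) (W : ι → Set (ℝ × E)) (A : ι → Set E)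
    (ζ : ℝ × E → ℝ) (hW : ∀ c ∈ t, IsOpen (W c))
    (hcover : ∀ r x, 0 < r → x ∈ U → ∃ c ∈ t, (r, x) ∈ W c)
    (hFζ : ∀ c y, (F c y).1 = ζ y) (hζ0 : ∀ c ∈ t, ∀ y ∈ W c, 0 ≤ ζ y)
    (hA : ∀ c ∈ t, ν (A c) ≠ ⊤) (hFA : ∀ c ∈ t, ∀ y ∈ W c, (F c y).2 ∈ A c)
    (hinj : ∀ c ∈ t, InjOn (F c) (W c)) (hd : ∀ c ∈ t, ∀ y ∈ W c, DifferentiableAt ℝ (F c) y)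
    {m : ℕ} (hm : 0 < m) {κ : ℝ} (hκ : 0 ≤ κ)
    (hbound : ∀ c ∈ t, ∀ y ∈ W c, (|(fderiv ℝ (F c) y (1, 0)).1| / f (ζ y)) ^ (m + 1) *
      g y.1 ^ m ≤ κ * (|(fderiv ℝ (F c) y).det| * (1 / f (ζ y))))
    (hcont : ∀ x ∈ U, ContinuousOn (fun r => ζ (r, x)) (Ici 0)) {C₀ : ℝ}
    (hC₀ : ∀ x ∈ U, ζ (0, x) ≤ C₀) (hlarge : ∀ x ∈ U, ∀ Z, ∃ r, 0 ≤ r ∧ Z ≤ ζ (r, x)) :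
    ∫⁻ s in Ici 0, ENNReal.ofReal (1 / f s) < ⊤ := by
  set p := recipPrimitive f
  have hpm : StrictMono p := strictMono_recipPrimitive hf hpos
  set G := (∫⁻ r in Ioi 0, ENNReal.ofReal (1 / g r)).toReal
  have hG : ∫⁻ r in Ioi 0, ENNReal.ofReal (1 / g r) = ENNReal.ofReal G :=
    (ENNReal.ofReal_toReal hgint.ne).symm
  have hG0 : 0 ≤ G := ENNReal.toReal_nonneg
  set V := (ν U).toReal
  have hV : ν U = ENNReal.ofReal V := (ENNReal.ofReal_toReal hU1).symm
  have hV0 : 0 < V := ENNReal.toReal_pos hU0 hU1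
  set K := (∑ c ∈ t, ν (A c)).toReal
  have hK : ∑ c ∈ t, ν (A c) = ENNReal.ofReal K :=
    (ENNReal.ofReal_toReal (ENNReal.sum_lt_top.2 fun c hc => (hA c hc).lt_top).ne).symm
  have hK0 : 0 ≤ K := ENNReal.toReal_nonneg
  -- M ≥ 2κK/V makes the coefficient of p(Z) at most half of V, so that it can be absorbed; M ≥ 1
  -- gives M ≤ M^m.
  set M := 1 + 2 * κ * K / V
  have hM1 : 1 ≤ M := le_add_of_nonneg_right (by positivity)
  have hM0 : 0 < M := one_pos.trans_le hM1
  -- The bound does not depend on Z, so p is bounded.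
  have key : ∀ Z, 0 ≤ Z → p Z ≤ 2 * (p C₀ + M * G) := by
    intro Z hZ
    have hpZ : 0 ≤ p Z := by
      have := hpm.monotone hZ
      rwa [show p 0 = 0 from recipPrimitive_zero] at this
    -- Only the part mapped below height Z counts: there the image has weighted volume at most a
    -- constant times p(Z).
    set P : ι → Set (ℝ × E) := fun c => W c ∩ F c ⁻¹' (Prod.fst ⁻¹' Iio Z)
    set φ : ι → ℝ × E → ℝ≥0∞ := fun c y =>
      ENNReal.ofReal |(fderiv ℝ (F c) y).det| * ENNReal.ofReal (1 / f (F c y).1)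
    have hPo : ∀ c ∈ t, IsOpen (P c) := fun c hc =>
      ContinuousOn.isOpen_inter_preimage
        (fun y hy => (hd c hc y hy).continuousAt.continuousWithinAt) (hW c hc)
        (isOpen_Iio.preimage continuous_fst)
    -- Length estimate on the radial line over x: p∘ζ climbs from at most p(C₀) to at least p(Z).
    have hpt : ∀ x ∈ U, ENNReal.ofReal (p Z - p C₀) ≤ ENNReal.ofReal (M * G) +
        ENNReal.ofReal (κ / M ^ m) * ∫⁻ r, ∑ c ∈ t, (P c).indicator (φ c) (r, x) := by
      intro x hx
      have hζd : ∀ r, 0 < r → ∀ c ∈ t, (r, x) ∈ W c →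
          HasDerivAt (fun r => p (ζ (r, x)))
            (1 / f (ζ (r, x)) * (fderiv ℝ (F c) (r, x) (1, 0)).1) r := by
        intro r hr c hc hW
        have h1 : HasDerivAt (fun r : ℝ => (r, x)) ((1 : ℝ), (0 : E)) r :=
          (hasDerivAt_id r).prodMk (hasDerivAt_const r x)
        have h2 := (ContinuousLinearMap.fst ℝ ℝ E).hasFDerivAt.comp_hasDerivAt r
          ((hd c hc _ hW).hasFDerivAt.comp_hasDerivAt r h1)
        have h3 := (hasDerivAt_recipPrimitive hf hpos (ζ (r, x))).comp r
          (h := fun r => ζ (r, x)) (h' := (fderiv ℝ (F c) (r, x) (1, 0)).1) (by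
            simpa [Function.comp_def, hFζ] using h2)
        rwa [max_eq_left (hζ0 c hc _ hW)] at h3
      have hηc : ContinuousOn (fun r => p (ζ (r, x))) (Ici 0) :=
        (continuous_iff_continuousAt.2 fun z =>
          (hasDerivAt_recipPrimitive hf hpos z).continuousAt).comp_continuousOn (hcont x hx)
      obtain ⟨r₁, hr₁, hZr⟩ := hlarge x hx Z
      refine (ofReal_sub_le_lintegral_abs_deriv hηc (fun r hr => ?_) (hpm.monotone (hC₀ x hx)) hr₁
        (hpm.monotone hZr)).trans ?_
      · obtain ⟨c, hc, hW⟩ := hcover r x hr hx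
        exact (hζd r hr c hc hW).differentiableAt
      have hmeas : MeasurableSet (Ioi 0 ∩ {r | p (ζ (r, x)) < p Z}) :=
        ((hηc.mono Ioi_subset_Ici_self).isOpen_inter_preimage isOpen_Ioi
          isOpen_Iio).measurableSet
      have hle : ∫⁻ r in Ioi 0 ∩ {r | p (ζ (r, x)) < p Z},
            ENNReal.ofReal |deriv (fun r => p (ζ (r, x))) r| ≤
          ∫⁻ r in Ioi 0 ∩ {r | p (ζ (r, x)) < p Z}, (ENNReal.ofReal M * ENNReal.ofReal (1 / g r) +
            ENNReal.ofReal (κ / M ^ m) * ∑ c ∈ t, (P c).indicator (φ c) (r, x)) := by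
        refine setLIntegral_mono' hmeas fun r hr => ?_
        obtain ⟨c, hc, hW⟩ := hcover r x hr.1 hx
        have hPc : (r, x) ∈ P c := ⟨hW, by
          change (F c (r, x)).1 < Z
          rw [hFζ]
          exact hpm.lt_iff_lt.1 hr.2⟩
        rw [(hζd r hr.1 c hc hW).deriv]
        have hfz := hpos _ (hζ0 c hc _ hW)
        have h1 := abs_le_div_add_pow_mul (x := 1 / f (ζ (r, x)) *
          (fderiv ℝ (F c) (r, x) (1, 0)).1) m (hgpos r hr.1) hM0
        have h2 := hbound c hc _ hW
        have h3 : |1 / f (ζ (r, x)) * (fderiv ℝ (F c) (r, x) (1, 0)).1| =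
            |(fderiv ℝ (F c) (r, x) (1, 0)).1| / f (ζ (r, x)) := by
          rw [abs_mul, abs_of_pos (one_div_pos.2 hfz)]
          ring
        have h4 : |1 / f (ζ (r, x)) * (fderiv ℝ (F c) (r, x) (1, 0)).1| ≤ M * (1 / g r) +
            κ / M ^ m * (|(fderiv ℝ (F c) (r, x)).det| * (1 / f (ζ (r, x)))) := by
          refine h1.trans ?_
          rw [h3, mul_one_div, div_mul_eq_mul_div κ]
          gcongr
        refine (ENNReal.ofReal_le_ofReal h4).trans ?_
        have hg0 := hgpos r hr.1
        rw [ENNReal.ofReal_add (by positivity) (by positivity), ENNReal.ofReal_mul hM0.le,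
          ENNReal.ofReal_mul (show 0 ≤ κ / M ^ m by positivity), ENNReal.ofReal_mul (abs_nonneg _)]
        gcongr
        -- One chart containing the point suffices; overlapping charts only enlarge the sum.
        refine le_trans (le_of_eq ?_) (Finset.single_le_sum
          (f := fun c => (P c).indicator (φ c) (r, x)) (fun _ _ => zero_le) hc)
        simp only [indicator_of_mem hPc, φ, hFζ]
      refine hle.trans ((lintegral_mono_set inter_subset_left).trans ?_)
      rw [lintegral_add_left (by fun_prop), lintegral_const_mul' _ _ ENNReal.ofReal_ne_top,
        lintegral_const_mul' _ _ ENNReal.ofReal_ne_top, hG, ← ENNReal.ofReal_mul hM0.le]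
      gcongr
      exact Measure.restrict_le_self
    have hρ : ∀ c ∈ t, AEMeasurable ((P c).indicator (φ c)) ((volume : Measure ℝ).prod ν) :=
      fun c hc => aemeasurable_indicator_abs_det_mul hf hpos _ (hPo c hc)
        (fun y hy => hd c hc y hy.1) fun y hy => by rw [hFζ]; exact hζ0 c hc y hy.1
    -- Area estimate: Fubini, then change of variables chart by chart.
    have htot : ∫⁻ x in U, (∫⁻ r, ∑ c ∈ t, (P c).indicator (φ c) (r, x)) ∂ν ≤
        ENNReal.ofReal (p Z) * ENNReal.ofReal K := by
      refine (setLIntegral_le_lintegral _ _).trans ?_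
      rw [← lintegral_prod_symm (μ := volume) (ν := ν)
        (fun y => ∑ c ∈ t, (P c).indicator (φ c) y) (Finset.aemeasurable_fun_sum _ hρ),
        lintegral_finsetSum' _ hρ, ← hK, Finset.mul_sum]
      refine Finset.sum_le_sum fun c hc => ?_
      rw [lintegral_indicator (hPo c hc).measurableSet]
      refine lintegral_abs_det_mul_le hf hpos hZ ν (hPo c hc) (fun y hy => hd c hc y hy.1)
        ((hinj c hc).mono inter_subset_left) fun y hy => ⟨⟨?_, hy.2.le⟩, hFA c hc y hy.1⟩
      rw [hFζ]
      exact hζ0 c hc y hy.1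
    have hint : ENNReal.ofReal (p Z - p C₀) * ν U ≤ ENNReal.ofReal (M * G) * ν U +
        ENNReal.ofReal (κ / M ^ m) * (ENNReal.ofReal (p Z) * ENNReal.ofReal K) := by
      have h1 := setLIntegral_mono' (μ := ν) hU hpt
      rw [lintegral_add_left measurable_const, lintegral_const_mul' _ _ ENNReal.ofReal_ne_top]
        at h1
      simp only [lintegral_const, Measure.restrict_apply MeasurableSet.univ, univ_inter] at h1
      refine h1.trans ?_
      gcongr
    rw [hV, ← ENNReal.ofReal_mul' hV0.le, ← ENNReal.ofReal_mul' hV0.le, ← ENNReal.ofReal_mul hpZ,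
      ← ENNReal.ofReal_mul (by positivity), ← ENNReal.ofReal_add (by positivity) (by positivity),
      ENNReal.ofReal_le_ofReal_iff (by positivity)] at hint
    have hsmall : κ / M ^ m * (p Z * K) ≤ V / 2 * p Z := by
      have h1 : M ≤ M ^ m := le_self_pow₀ hM1 hm.ne'
      have h2 : 2 * κ * K / V ≤ M := by simp only [M]; linarith
      have h3 : 2 * κ * K ≤ M * V := (div_le_iff₀ hV0).1 h2
      have h4 : κ * K / M ^ m ≤ V / 2 := by
        rw [div_le_iff₀ (by positivity)]
        have := mul_le_mul_of_nonneg_right h1 hV0.le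
        linarith
      calc κ / M ^ m * (p Z * K) = κ * K / M ^ m * p Z := by ring
        _ ≤ _ := by gcongr
    have h5 : V * p Z ≤ V * (2 * (p C₀ + M * G)) := by linarith
    exact le_of_mul_le_mul_left h5 hV0
  exact (lintegral_Ici_one_div_le hf hpos key).trans_lt ENNReal.ofReal_lt_top

end Modulus

/-! ### Conformal ends have finite length -/

section ConformalEnd

variable {E : Type*} [NormedAddCommGroup E] [NormedSpace ℝ E] [FiniteDimensional ℝ E]
  {H : Type*} [TopologicalSpace H] {I : ModelWithCorners ℝ E H} [I.Boundaryless]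
  {N : Type*} [TopologicalSpace N] [ChartedSpace H N] [IsManifold I ∞ N]

theorem exists_bound_fst_image [CompactSpace N] {Ψ : ℝ × N → ℝ × N} {s : Set ℝ}
    (hs : IsCompact s) (hΨ : ContinuousOn Ψ (s ×ˢ univ)) :
    ∃ C, ∀ z ∈ s, ∀ x : N, (Ψ (z, x)).1 ≤ C := by
  obtain ⟨C, hC⟩ := ((hs.prod isCompact_univ).image_of_continuousOn
    (continuous_fst.comp_continuousOn hΨ)).bddAbove
  exact ⟨C, fun z hz x => hC ⟨(z, x), ⟨hz, mem_univ _⟩, rfl⟩⟩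

/-- The length-area inequality is applied to the inverse Ψ. Radial lines over a single coordinate
ball U of N suffice in the source, while finitely many charts of N are needed in the target since
the images may wander over all of N. -/
theorem lintegral_one_div_lt_top_of_isConformalDiffeoOn [CompactSpace N] [Nonempty N]
    (hE : 0 < Module.finrank ℝ E) {h h' : SmoothMetric I N} {f g : ℝ → ℝ}
    (hf : ContinuousOn f (Ici 0)) (hpos : ∀ z ∈ Ici (0 : ℝ), 0 < f z) (hg : Measurable g)
    (hgpos : ∀ r, 0 < r → 0 < g r) (hgint : ∫⁻ r in Ioi 0, ENNReal.ofReal (1 / g r) < ⊤)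
    {z₀ : ℝ} (hz₀ : 0 ≤ z₀) {Φ : ℝ × N → ℝ × N}
    (hΦ : IsConformalDiffeoOn (𝓘(ℝ, ℝ).prod I) (warped f h) (halfCyl N z₀) (warped g h')
      (halfCyl N 0) Φ) :
    ∫⁻ s in Ici 0, ENNReal.ofReal (1 / f s) < ⊤ := by
  borelize E
  obtain ⟨hbij, hΦs, ⟨Ψ, hinv, hΨs⟩, u, -, hu, hconf⟩ := hΦ
  have hmaps : MapsTo Ψ (halfCyl N 0) (halfCyl N z₀) := by
    intro q hq
    obtain ⟨p, hp, rfl⟩ := hbij.surjOn hq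
    rwa [hinv.1 hp]
  have hΦΨ : ∀ q ∈ halfCyl N 0, Φ (Ψ q) = q := fun q hq => hinv.2 hq
  obtain ⟨c'⟩ := ‹Nonempty N›
  obtain ⟨ε', hε', δ', hδ', B', hball', hdet'⟩ := exists_ball_det_chartForm h' c'
  choose ε hε δ hδ B hball hdet using exists_ball_det_chartForm h
  obtain ⟨t, ht⟩ := exists_finite_chart_cover (I := I)
    (fun c => Metric.ball (extChartAt I c c) (ε c)) fun c => Metric.ball_mem_nhds _ (hε c)
  set U := Metric.ball (extChartAt I c' c') ε'
  set Q : Set (ℝ × E) := Ioi 0 ×ˢ U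
  have hQ : IsOpen Q := isOpen_Ioi.prod Metric.isOpen_ball
  have hQT : ∀ y ∈ Q, cylChartSymm I c' y ∈ halfCyl N 0 := fun y hy =>
    ⟨le_of_lt (mem_Ioi.1 hy.1), mem_univ _⟩
  have hcyl : ContinuousOn (cylChartSymm I c') Q := fun y hy =>
    (hasMFDerivAt_cylChartSymm (hball' hy.2)).continuousAt.continuousWithinAt
  have hΨc : ContinuousOn (fun y => Ψ (cylChartSymm I c' y)) Q :=
    hΨs.continuousOn.comp hcyl hQT
  set Vs : N → Set N := fun c =>
    (extChartAt I c).source ∩ extChartAt I c ⁻¹' Metric.ball (extChartAt I c c) (ε c)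
  have hVs : ∀ c, IsOpen (Vs c) := fun c =>
    (continuousOn_extChartAt c).isOpen_inter_preimage (isOpen_extChartAt_source c)
      Metric.isOpen_ball
  set W : N → Set (ℝ × E) := fun c =>
    Q ∩ (fun y => Ψ (cylChartSymm I c' y)) ⁻¹' (Prod.snd ⁻¹' Vs c)
  have hderiv : ∀ c, ∀ y ∈ W c, ∃ D : (ℝ × E) →L[ℝ] (ℝ × E),
      HasFDerivAt (inCylCharts I Ψ c' c) D y ∧
      ∀ v w, warpForm (f (inCylCharts I Ψ c' c y).1) (chartForm h c (inCylCharts I Ψ c' c y).2)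
        (D v) (D w) =
          (u (Ψ (cylChartSymm I c' y)))⁻¹ * warpForm (g y.1) (chartForm h' c' y.2) v w :=
    fun c y hy => exists_hasFDerivAt_inCylCharts hΨs hy.1.1 (hball' hy.1.2) hy.2.1
      (warped_mfderiv_inverse hΦs hΨs hmaps hΦΨ hu hconf hy.1.1)
  have hζ : ∀ y ∈ Q, z₀ ≤ (Ψ (cylChartSymm I c' y)).1 := fun y hy => (hmaps (hQT y hy)).1
  -- The image of the compact boundary {0} × N has bounded height.
  obtain ⟨C₀, hC₀⟩ := exists_bound_fst_image (s := {0}) isCompact_singleton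
    (hΨs.continuousOn.mono (prod_mono (singleton_subset_iff.2 self_mem_Ici) subset_rfl))
  refine lintegral_one_div_lt_top_of_jacobian_bound hf hpos hg hgpos hgint Measure.addHaar
    (U := U) measurableSet_ball (Metric.measure_ball_pos _ _ hε').ne' measure_ball_lt_top.ne t
    (fun c => inCylCharts I Ψ c' c) W (fun c => Metric.ball (extChartAt I c c) (ε c))
    (fun y => (Ψ (cylChartSymm I c' y)).1)
    (fun c _ => hΨc.isOpen_inter_preimage hQ ((hVs c).preimage continuous_snd)) ?_
    (fun _ _ => rfl) (fun c _ y hy => hz₀.trans (hζ y hy.1))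
    (fun _ _ => measure_ball_lt_top.ne) (fun c _ y hy => hy.2.2) ?_ ?_ hE
    (κ := ∑ c ∈ t, √ (B c / δ')) (Finset.sum_nonneg fun _ _ => Real.sqrt_nonneg _) ?_ ?_
    (C₀ := C₀) (fun x _ => hC₀ 0 rfl _) ?_
  · intro r x hr hx
    obtain ⟨c, hc, hcV⟩ := ht (Ψ (cylChartSymm I c' (r, x))).2
    exact ⟨c, hc, ⟨hr, hx⟩, hcV⟩
  · intro c _ y hy y' hy' heq
    have h1 : Ψ (cylChartSymm I c' y) = Ψ (cylChartSymm I c' y') :=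
      Prod.ext (congrArg Prod.fst heq :) ((extChartAt I c).injOn hy.2.1 hy'.2.1
        (congrArg Prod.snd heq :))
    have h2 : cylChartSymm I c' y = cylChartSymm I c' y' := by
      rw [← hΦΨ _ (hQT y hy.1), h1, hΦΨ _ (hQT y' hy'.1)]
    exact Prod.ext (congrArg Prod.fst h2 :) ((extChartAt I c').symm.injOn (hball' hy.1.2)
      (hball' hy'.1.2) (congrArg Prod.snd h2 :))
  · intro c _ y hy
    obtain ⟨D, hD, -⟩ := hderiv c y hy
    exact hD.differentiableAt
  · intro c hc y hy
    obtain ⟨D, hD, hDc⟩ := hderiv c y hy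
    rw [hD.fderiv]
    have h1 := abs_div_pow_mul_le_of_conformal
      (hpos _ (show _ ∈ Ici (0 : ℝ) from hz₀.trans (hζ y hy.1))) (hgpos _ hy.1.1)
      (inv_pos.2 (hu _ (hmaps (hQT y hy.1)))) (chartForm_self_nonneg h c _) hDc hδ'
      (hdet' _ hy.1.2).1 (hdet c _ hy.2.2).2
    refine h1.trans (mul_le_mul_of_nonneg_right ?_ ?_)
    · exact Finset.single_le_sum (f := fun c => √ (B c / δ')) (fun _ _ => Real.sqrt_nonneg _) hc
    · exact mul_nonneg (abs_nonneg _) (one_div_nonneg.2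
        (hpos _ (show _ ∈ Ici (0 : ℝ) from hz₀.trans (hζ y hy.1))).le)
  · intro x _
    have h1 : ContinuousOn (fun r : ℝ => Ψ (r, (extChartAt I c').symm x)) (Ici 0) :=
      hΨs.continuousOn.comp (by fun_prop) fun r hr => ⟨hr, mem_univ _⟩
    exact continuous_fst.comp_continuousOn h1
  · intro x hx Z
    -- Properness: Φ sends the compact piece [z₀, Z] × N to heights at most R, so a point of the
    -- reference end above R has its preimage above Z.
    obtain ⟨R, hR⟩ := exists_bound_fst_image (s := Icc z₀ Z) isCompact_Icc
      (hΦs.continuousOn.mono (prod_mono Icc_subset_Ici_self subset_rfl))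
    refine ⟨max R 0 + 1, by positivity, ?_⟩
    by_contra! hlt
    have hq : cylChartSymm I c' (max R 0 + 1, x) ∈ halfCyl N 0 :=
      ⟨show (0 : ℝ) ≤ max R 0 + 1 by positivity, mem_univ _⟩
    have h1 := hR (Ψ (cylChartSymm I c' (max R 0 + 1, x))).1 ⟨(hmaps hq).1, hlt.le⟩
      (Ψ (cylChartSymm I c' (max R 0 + 1, x))).2
    rw [Prod.mk.eta, hΦΨ _ hq] at h1
    exact absurd (le_max_left R 0) (not_le.2 ((lt_add_one _).trans_le h1))

end ConformalEnd

end WarpedConformal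

theorem mainTheorem7 (n : ℕ) (hn : 3 ≤ n)
    {N : Type*} [TopologicalSpace N] [ChartedSpace (EuclideanSpace ℝ (Fin (n - 1))) N]
    [IsManifold (𝓡 (n - 1)) ∞ N] [CompactSpace N] [T2Space N] [Nonempty N]
    (k : SignType) (h : WarpedConformal.SmoothMetric (𝓡 (n - 1)) N)
    (hk : WarpedConformal.HasConstScalar n k h)
    (f : ℝ → ℝ) (hf : ContDiffOn ℝ ∞ f (Ici 0)) (hpos : ∀ z ∈ Ici (0 : ℝ), 0 < f z) :
    List.TFAE [
      -- `g_f` is conformal to a reference metric with the same `k` and `h`, through a change of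
      -- the radial coordinate, on all of `[0, ∞) × N` where possible
      ∃ z₀ : ℝ, 0 ≤ z₀ ∧
        ((∫⁻ s in Ici (0 : ℝ), ENNReal.ofReal (1 / f s)) <
          (∫⁻ r in Ioi (0 : ℝ), ENNReal.ofReal (1 / WarpedConformal.profile k r)) → z₀ = 0) ∧
        ∃ r₀ : ℝ, 0 < r₀ ∧ ∃ K : ℝ → ℝ,
          WarpedConformal.IsConformalDiffeoOn (𝓘(ℝ, ℝ).prod (𝓡 (n - 1)))
            (WarpedConformal.warped f h) (WarpedConformal.halfCyl N z₀)
            (WarpedConformal.refMetric k r₀ h) (WarpedConformal.halfCyl N 0) (Prod.map K id),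
      -- the end is conformal to some locally hyperbolic reference metric
      WarpedConformal.EndConformalToLocallyHyperbolic n (WarpedConformal.warped f h),
      (∫⁻ s in Ici (0 : ℝ), ENNReal.ofReal (1 / f s)) < ⊤] ∧
    (¬ (∫⁻ s in Ici (0 : ℝ), ENNReal.ofReal (1 / f s)) < ⊤ →
      ∃ K : ℝ → ℝ,
        WarpedConformal.IsConformalDiffeoOn (𝓘(ℝ, ℝ).prod (𝓡 (n - 1)))
          (WarpedConformal.warped f h) (WarpedConformal.halfCyl N 0)
          (WarpedConformal.warped (fun z => Real.exp (-z)) h) (WarpedConformal.halfCyl N 0)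
          (Prod.map K id)) ∧
    WarpedConformal.IsCompleteOn (𝓘(ℝ, ℝ).prod (𝓡 (n - 1)))
      (WarpedConformal.warped (fun z => Real.exp (-z)) h) (WarpedConformal.halfCyl N 0) ∧
    WarpedConformal.riemannianVolume (𝓘(ℝ, ℝ).prod (𝓡 (n - 1)))
      (WarpedConformal.warped (fun z => Real.exp (-z)) h) (WarpedConformal.halfCyl N 0) < ⊤ := by
  have hE : 0 < Module.finrank ℝ (EuclideanSpace ℝ (Fin (n - 1))) := by
    rw [finrank_euclideanSpace_fin]; omega
  refine ⟨?_, fun hinf => ?_, WarpedConformal.isCompleteOn_cusp h,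
    WarpedConformal.riemannianVolume_cusp_lt_top hE h⟩
  · tfae_have 1 → 2
    | ⟨z₀, hz₀, _, r₀, hr₀, K, hK⟩ => ⟨k, h, r₀, z₀, Prod.map K id, hk, hr₀, hz₀, hK⟩
    tfae_have 2 → 3
    | ⟨k', h', r₀, z₀, Φ, _, hr₀, hz₀, hΦ⟩ =>
      WarpedConformal.lintegral_one_div_lt_top_of_isConformalDiffeoOn hE hf.continuousOn hpos
        ((WarpedConformal.contDiff_profile k').continuous.comp
          (continuous_id.add continuous_const)).measurable
        (fun r hr => WarpedConformal.profile_pos k' (add_pos hr hr₀))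
        (WarpedConformal.lintegral_one_div_profile_lt_top k' hr₀) hz₀ hΦ
    tfae_have 3 → 1 := by
      intro hfin
      obtain ⟨z₀, hz₀, hcond, r₀, hr₀, K, hK, hK0, hlim, hK'⟩ :=
        WarpedConformal.exists_radial_change hf hpos k hfin
      have hsub : ∀ z ∈ Ici z₀, 0 < f z := fun z hz => hpos z (hz₀.trans hz)
      have hprof : ∀ z ∈ Ici z₀, 0 < WarpedConformal.profile k (K z + r₀) := fun z hz =>
        WarpedConformal.profile_pos k (hK' z hz).1
      exact ⟨z₀, hz₀, hcond, r₀, hr₀, K, WarpedConformal.isConformalDiffeoOn_prodMap_id h hK hK0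
        hlim (fun z hz => (hK' z hz).2) (fun z hz => div_pos (hprof z hz) (hsub z hz))
        fun z hz => (div_mul_cancel₀ _ (hsub z hz).ne').symm⟩
    tfae_finish
  · obtain ⟨K, hK, hK0, hlim, hK'⟩ := WarpedConformal.exists_radial_change_cusp hf hpos hinf
    exact ⟨K, WarpedConformal.isConformalDiffeoOn_prodMap_id h hK hK0 hlim hK'
      (fun z hz => div_pos (Real.exp_pos _) (hpos z hz))
      fun z hz => (div_mul_cancel₀ _ (hpos z hz).ne').symm⟩
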